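/- Let $\alpha>0$ and $\epsilon_0>0$ (for instance $\epsilon_0=1$). There is a constant $C>0$, depending only on $\alpha$ and $\epsilon_0$, such that the following holds. Let $\mu$ be a probability measure on a measurable space $\mathcal X$, let $m\ge 1$, let $\varphi_1,\dots,\varphi_m$ be an orthonormal system in $L^2_\mu$ of real-valued functions on $\mathcal X$, and let $V_m$ be its linear span. Write $\|g\|^2=\int g^2\,d\mu$, let $P_{V_m}$ be the $L^2_\mu$-orthogonal projection onto $V_m$, and put $w_m=\frac1m\sum_{j=1}^m\varphi_j^2$, $\nu_m=w_m\mu$. Let $w:\mathcal X\to[0,\infty)$ be a probability density with respect to $\mu$ with $w\ge\alpha w_m$ $\mu$-almost everywhere, and put $\nu=w\mu$. Set $\xi=0$ if $\nu=\nu_m$ and $\xi=1$ otherwise. For $n\ge m$, let $\Phi^w(\mathbf x)\in\mathbb R^{n\times m}$ be the matrix with entries $w(x_i)^{-1/2}\varphi_j(x_i)$, and let $\gamma_n^\nu$ be the (volume sampling) distribution on $\mathcal X^n$ given by $$d\gamma_n^\nu(\mathbf x)=\frac{(n-m)!}{n!}\det\big(\Phi^w(\mathbf x)^T\Phi^w(\mathbf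 x)\big)\,d\nu^{\otimes n}(\mathbf x).$$ A weighted least-squares projection of $f$ based on $\mathbf x=(x_1,\dots,x_n)$ is a minimizer over $g\in V_m$ of $\frac1n\sum_{i=1}^n w(x_i)^{-1}(f(x_i)-g(x_i))^2$. Let $f\in L^2_\mu$, $0<\epsilon\le\epsilon_0$, $n\ge m$ and $$n\ \ge\ C\Big(m\log(\epsilon^{-1}m)+m(1+\xi m)\epsilon^{-1}\Big).$$ 1. For every $r\ge 1$, if $\hat f^{(1)},\dots,\hat f^{(r)}$ are (almost surely) weighted least-squares projections of $f$ based on independent samples $\mathbf x^{(1)},\dots,\mathbf x^{(r)}$ drawn from $\gamma_n^\nu$, then the average $\bar f^r=\frac1r\sum_{k=1}^r\hat f^{(k)}$ has integrable squared error and $$\mathbb E\big(\|f-\bar f^r\|^2\big)\le\Big(1+\frac1r(1+\xi m)\epsilon\Big)\|f-P_{V_m}f\|^2 .$$ 2. If $(\hat f^{(k)})_{k\ge1}$ are built in this way from an infinite sequence of independent samples from $\gamma_n^\nu$, then, as $r\to\infty$, $\mathbb E(\|f-\bar f^r\|^2)\to\|f-P_{V_m}f\|^2$ and $\mathbb E(\|\bar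 f^r-P_{V_m}f\|^2)\to 0$, where for every $r\ge1$ the variable $\|\bar f^r-P_{V_m}f\|^2$ is integrable. -/

import Mathlib

open MeasureTheory ProbabilityTheory Filter Topology

universe u v

namespace VolumeSampling

variable {X : Type*}

/-- The approximation space `V_m`: the real linear span of the functions `φ_1, …, φ_m`. -/
def approxSpace {m : ℕ} (φ : Fin m → X → ℝ) : Submodule ℝ (X → ℝ) :=
  Submodule.span ℝ (Set.range φ)

/-- The density `w_m = (1/m) ∑_j φ_j²`. -/
noncomputable def optDensity {m : ℕ} (φ : Fin m → X → ℝ) (x : X) : ℝ :=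
  (1 / (m : ℝ)) * ∑ j, φ j x ^ 2

/-- The weighted feature matrix `Φ^w(𝐱)`, with `i`-th row `w(x_i)^{-1/2} φ(x_i)ᵀ`. -/
noncomputable def featureMatrix {m n : ℕ} (w : X → ℝ) (φ : Fin m → X → ℝ) (x : Fin n → X) :
    Matrix (Fin n) (Fin m) ℝ :=
  Matrix.of fun i j => (√(w (x i)))⁻¹ * φ j (x i)

/-- The squared empirical semi-norm `‖g‖_n² = (1/n) ∑_i w(x_i)⁻¹ g(x_i)²`. -/
noncomputable def empSqNorm {n : ℕ} (w : X → ℝ) (x : Fin n → X) (g : X → ℝ) : ℝ :=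
  (1 / (n : ℝ)) * ∑ i, (w (x i))⁻¹ * g (x i) ^ 2

/-- `g` is a weighted least-squares projection of `f` onto `V` based on the points `x` and the
weight `w`: a minimizer over `V` of the empirical semi-norm of the error. -/
def IsLeastSquaresProj {n : ℕ} (w : X → ℝ) (V : Submodule ℝ (X → ℝ)) (x : Fin n → X)
    (f g : X → ℝ) : Prop :=
  g ∈ V ∧ ∀ h ∈ V, empSqNorm w x (f - g) ≤ empSqNorm w x (f - h)

/-- The average `(1/r) ∑_k f_k`. -/
noncomputable def average {r : ℕ} (F : Fin r → X → ℝ) : X → ℝ :=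
  fun y => (1 / (r : ℝ)) * ∑ k, F k y

variable [MeasurableSpace X]

/-- The squared norm of `L²_μ`. -/
noncomputable def sqNorm (μ : Measure X) (g : X → ℝ) : ℝ := ∫ x, g x ^ 2 ∂μ

/-- `φ_1, …, φ_m` are orthonormal elements of `L²_μ`, that is, an orthonormal basis of
their span. -/
structure IsOrthonormalSystem {m : ℕ} (μ : Measure X) (φ : Fin m → X → ℝ) : Prop where
  memLp : ∀ j, MemLp (φ j) 2 μ
  integral_mul : ∀ i j, ∫ x, φ i x * φ j x ∂μ = if i = j then 1 else 0

/-- The `L²_μ`-orthogonal projection `P_{V_m} f` onto the span of the orthonormal system `φ`;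
see `l2Proj_mem` and `integral_sub_l2Proj_mul`. -/
noncomputable def l2Proj {m : ℕ} (μ : Measure X) (φ : Fin m → X → ℝ) (f : X → ℝ) : X → ℝ :=
  ∑ j, (∫ y, f y * φ j y ∂μ) • φ j

theorem l2Proj_mem {m : ℕ} (μ : Measure X) (φ : Fin m → X → ℝ) (f : X → ℝ) :
    l2Proj μ φ f ∈ approxSpace φ :=
  Submodule.sum_mem _ fun j _ =>
    Submodule.smul_mem _ _ (Submodule.subset_span (Set.mem_range_self j))

theorem memLp_of_mem {m : ℕ} {μ : Measure X} {φ : Fin m → X → ℝ}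
    (hφ : IsOrthonormalSystem μ φ) {g : X → ℝ} (hg : g ∈ approxSpace φ) : MemLp g 2 μ := by
  induction hg using Submodule.span_induction with
  | mem x hx => obtain ⟨j, rfl⟩ := hx; exact hφ.memLp j
  | zero => exact MemLp.zero
  | add x y _ _ hx hy => exact hx.add hy
  | smul a x _ hx => exact hx.const_smul a

/-- The error of `l2Proj` is orthogonal to the space, so `l2Proj` is the orthogonal projection. -/
theorem integral_sub_l2Proj_mul {m : ℕ} {μ : Measure X} {φ : Fin m → X → ℝ}
    (hφ : IsOrthonormalSystem μ φ) {f : X → ℝ} (hf : MemLp f 2 μ)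
    {g : X → ℝ} (hg : g ∈ approxSpace φ) :
    ∫ x, (f x - l2Proj μ φ f x) * g x ∂μ = 0 := by
  have hp : MemLp (f - l2Proj μ φ f) 2 μ := hf.sub (memLp_of_mem hφ (l2Proj_mem μ φ f))
  induction hg using Submodule.span_induction with
  | mem x hx =>
    obtain ⟨i, rfl⟩ := hx
    have h1 : Integrable (fun x => f x * φ i x) μ := hf.integrable_mul (hφ.memLp i)
    have h2 : ∀ j, Integrable (fun x => (∫ y, f y * φ j y ∂μ) * (φ j x * φ i x)) μ := fun j =>
      ((hφ.memLp j).integrable_mul (hφ.memLp i)).const_mul _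
    have h3 : ∀ x, (f x - l2Proj μ φ f x) * φ i x
        = f x * φ i x - ∑ j, (∫ y, f y * φ j y ∂μ) * (φ j x * φ i x) := by
      intro x
      simp [l2Proj, Finset.sum_apply, sub_mul, Finset.sum_mul, mul_assoc]
    simp_rw [h3]
    rw [integral_sub h1 (integrable_finsetSum _ fun j _ => h2 j),
      integral_finsetSum _ fun j _ => h2 j]
    simp [integral_const_mul, hφ.integral_mul]
  | zero => simp
  | add x y hx hy ihx ihy =>
    have e1 : Integrable (fun t => (f t - l2Proj μ φ f t) * x t) μ :=
      hp.integrable_mul (memLp_of_mem hφ hx)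
    have e2 : Integrable (fun t => (f t - l2Proj μ φ f t) * y t) μ :=
      hp.integrable_mul (memLp_of_mem hφ hy)
    simp only [Pi.add_apply, mul_add]
    rw [integral_add e1 e2, ihx, ihy, add_zero]
  | smul a x _ ih =>
    simp only [Pi.smul_apply, smul_eq_mul, mul_left_comm _ a]
    rw [integral_const_mul, ih, mul_zero]

/-- The measure `w μ` with density `w` with respect to `μ`. -/
noncomputable def densityMeasure (μ : Measure X) (w : X → ℝ) : Measure X :=
  μ.withDensity fun x => ENNReal.ofReal (w x)

/-- The volume sampling distribution `γ_n^ν` on `X^n`, for `ν = w μ` and `n ≥ m`: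
`dγ_n^ν(𝐱) = ((n-m)!/n!) det(Φ^w(𝐱)ᵀ Φ^w(𝐱)) dν^{⊗n}(𝐱)`. -/
noncomputable def volumeSampling {m : ℕ} (μ : Measure X) (w : X → ℝ) (φ : Fin m → X → ℝ)
    (n : ℕ) : Measure (Fin n → X) :=
  (Measure.pi fun _ : Fin n => densityMeasure μ w).withDensity fun x =>
    ENNReal.ofReal (((n - m).factorial : ℝ) / (n.factorial : ℝ) *
      ((featureMatrix w φ x).transpose * featureMatrix w φ x).det)

open Classical in
/-- `ξ = 0` if `ν = ν_m`, and `ξ = 1` otherwise, where `ν = w μ` and `ν_m = w_m μ`. -/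
noncomputable def xi {m : ℕ} (μ : Measure X) (w : X → ℝ) (φ : Fin m → X → ℝ) : ℝ :=
  if densityMeasure μ w = densityMeasure μ (optDensity φ) then 0 else 1

end VolumeSampling

/-! A weighted least-squares projection equals `P f + ∑ z_k φ_k`, where `z` is the least-squares
coefficient vector of the residual `f - P f`. If `z` has mean zero under volume sampling, then
Pythagoras and independence make the mean error of an average of `r` projections equal to `‖f - P
f‖² + E|z|² / r`. Both claims thus reduce to `E z = 0` and `E|z|² ≤ ε ‖f - P f‖²`.

Write `D = det(ΦᵀΦ)`, proportional to the sampling density. Cramer's rule turns `D z_k` into `det(Φᵀ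
Φ')`, with `Φ'` obtained by replacing column `k` of `Φ` by the residual data. The Andréief identity
(`integral_det_transpose_mul`) integrates this to a determinant with a zero column, so `z` is
unbiased. Cauchy–Schwarz on the minors in Cauchy–Binet gives `D z_k² ≤ det(Φ'ᵀ Φ')`, whose integral
is explicit; alone it yields only `E|z|² ≤ m ‖f - P f‖²`.

For the sharp bound, compare `zᵀGz` with `s|z|²`, where `G = ΦᵀΦ`. If `zᵀGz ≥ s|z|²`, then `|z|² ≤
s⁻¹ zᵀGz`, and the mean of `zᵀGz` is at most `K ‖f - P f‖²`, where `K` bounds `∑ φ_j²/w`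
(`IsDesign.integral_det_mul_quadForm_le`). Otherwise `G` has a small eigenvalue, and so has the Gram
matrix of every subset of the points. Expand `det(Φ'ᵀ Φ')` by Cauchy–Binet: each term involves at
most `m` points, and the remaining ones, at least `n - m`, are independent of them. Hence the bad
event can be charged to those points alone under the product measure, where a matrix Chernoff bound
applies (`lintegral_trace_resolvent_pow_le`).

That bound concerns `E tr (G + a)⁻ᵖ`. Deleting one point changes the relevant resolvent moment by a
factor at most `2`, so exchangeability trades one power of the resolvent for one more sample and a
factor `2/(n+1)`. Iterating gives `m (2/(n+1))ᵖ`. Taking `a = s = n/16` and `p` of order `αn/m`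
makes both contributions at most `ε/2`. -/

namespace VolumeSampling

open Matrix

/-! ### Determinants, Cauchy–Binet and least-squares coefficients. -/

theorem det_transpose_mul_eq_sum {ι κ : Type*} [Fintype ι] [DecidableEq ι] [Fintype κ]
    (Φ Ψ : Matrix κ ι ℝ) :
    (Φᵀ * Ψ).det = ∑ g : ι → κ, (∏ k, Φ (g k) k) * (Ψ.submatrix g id).det := by
  have h : (Φᵀ * Ψ).det = detRowAlternating (fun k => ∑ i, Φ i k • Ψ i) := by
    change _ = Matrix.det (fun k => ∑ i, Φ i k • Ψ i)
    congr 1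
    ext k l
    simp [Matrix.mul_apply]
  rw [h]
  classical
  have := (detRowAlternating (n := ι) (R := ℝ)).toMultilinearMap.map_sum
    (fun k (i : κ) => Φ i k • Ψ i)
  refine this.trans (Finset.sum_congr rfl fun g _ => ?_)
  rw [MultilinearMap.map_smul_univ]
  rfl

/-- The **Cauchy–Binet formula**, as a sum over all selections of rows. -/
theorem factorial_mul_det_transpose_mul {ι κ : Type*} [Fintype ι] [DecidableEq ι] [Fintype κ]
    (Φ Ψ : Matrix κ ι ℝ) :
    ((Fintype.card ι).factorial : ℝ) * (Φᵀ * Ψ).det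
      = ∑ g : ι → κ, (Φ.submatrix g id).det * (Ψ.submatrix g id).det := by
  -- Relabelling the selection `g` by `σ` changes the minor of `Ψ` only by `sign σ`. Summing the
  -- resulting expansions over all `σ` assembles the minor of `Φ` and accounts for the factorial.
  have h : ∀ σ : Equiv.Perm ι, (Φᵀ * Ψ).det
      = ∑ g : ι → κ, (Equiv.Perm.sign σ : ℤ) * (∏ k, Φ (g (σ k)) k) *
        (Ψ.submatrix g id).det := by
    intro σ
    rw [det_transpose_mul_eq_sum]
    refine Fintype.sum_equiv (σ.arrowCongr (Equiv.refl κ)) _ _ fun g => ?_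
    have h1 : (Ψ.submatrix (g ∘ σ.symm) id).det
        = (Equiv.Perm.sign σ : ℤ) * (Ψ.submatrix g id).det := by
      have := Matrix.det_permute σ.symm (Ψ.submatrix g id)
      rw [Matrix.submatrix_submatrix] at this
      simpa using this
    have h2 : σ.arrowCongr (Equiv.refl κ) g = g ∘ σ.symm := rfl
    rw [h2, h1]
    simp only [Function.comp_apply, Equiv.symm_apply_apply]
    have h3 : ((Equiv.Perm.sign σ : ℤ) : ℝ) * ((Equiv.Perm.sign σ : ℤ) : ℝ) = 1 := by
      exact_mod_cast Int.units_coe_mul_self _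
    linear_combination (-(∏ k, Φ (g k) k) * (Ψ.submatrix g id).det) * h3
  have h4 : ((Fintype.card ι).factorial : ℝ) * (Φᵀ * Ψ).det
      = ∑ σ : Equiv.Perm ι, (Φᵀ * Ψ).det := by
    simp [Fintype.card_perm]
  rw [h4, Finset.sum_congr rfl fun σ _ => h σ, Finset.sum_comm]
  refine Finset.sum_congr rfl fun g _ => ?_
  rw [← Finset.sum_mul]
  congr 1
  rw [Matrix.det_apply']
  rfl

theorem det_gram_nonneg {ι κ : Type*} [Fintype ι] [DecidableEq ι] [Fintype κ]
    (Φ : Matrix κ ι ℝ) : 0 ≤ (Φᵀ * Φ).det := by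
  have h := factorial_mul_det_transpose_mul Φ Φ
  have h0 : (0 : ℝ) < (Fintype.card ι).factorial := by positivity
  have h1 : 0 ≤ ∑ g : ι → κ, (Φ.submatrix g id).det * (Φ.submatrix g id).det :=
    Finset.sum_nonneg fun g _ => mul_self_nonneg _
  rw [← h] at h1
  exact nonneg_of_mul_nonneg_right h1 h0

/-- Cauchy–Schwarz for the vectors of minors appearing in Cauchy–Binet. -/
theorem det_transpose_mul_sq_le {ι κ : Type*} [Fintype ι] [DecidableEq ι] [Fintype κ]
    (Φ Ψ : Matrix κ ι ℝ) :
    (Φᵀ * Ψ).det ^ 2 ≤ (Φᵀ * Φ).det * (Ψᵀ * Ψ).det := by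
  have h0 : (0 : ℝ) < (Fintype.card ι).factorial := by positivity
  have h := Finset.sum_mul_sq_le_sq_mul_sq (Finset.univ : Finset (ι → κ))
    (fun g => (Φ.submatrix g id).det) (fun g => (Ψ.submatrix g id).det)
  simp only [pow_two (Matrix.det (submatrix _ _ _))] at h
  rw [← factorial_mul_det_transpose_mul, ← factorial_mul_det_transpose_mul,
    ← factorial_mul_det_transpose_mul] at h
  have : (Fintype.card ι).factorial ^ 2 * (Φᵀ * Ψ).det ^ 2
      ≤ (Fintype.card ι).factorial ^ 2 * ((Φᵀ * Φ).det * (Ψᵀ * Ψ).det) := by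
    linarith
  exact le_of_mul_le_mul_left this (by positivity)

/-- The coefficients of the least-squares fit of the data `r` by the columns of `Φ`. -/
noncomputable def lsCoeff {ι κ : Type*} [Fintype ι] [DecidableEq ι] [Fintype κ]
    (Φ : Matrix κ ι ℝ) (r : κ → ℝ) : ι → ℝ :=
  (Φᵀ * Φ)⁻¹ *ᵥ (Φᵀ *ᵥ r)

/-- Cramer's rule for the normal equations. It survives a singular Gram matrix because
`det_transpose_mul_sq_le` then forces the right-hand side to vanish. -/
theorem det_mul_lsCoeff {ι κ : Type*} [Fintype ι] [DecidableEq ι] [Fintype κ]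
    (Φ : Matrix κ ι ℝ) (r : κ → ℝ) (k : ι) :
    (Φᵀ * Φ).det * lsCoeff Φ r k = (Φᵀ * Φ.updateCol k r).det := by
  by_cases h : (Φᵀ * Φ).det = 0
  · have h1 := det_transpose_mul_sq_le Φ (Φ.updateCol k r)
    rw [h, zero_mul] at h1
    rw [h, zero_mul]
    exact ((pow_eq_zero_iff two_ne_zero).1 (le_antisymm h1 (sq_nonneg _))).symm
  have h1 : Φᵀ * Φ.updateCol k r = (Φᵀ * Φ).updateCol k (Φᵀ *ᵥ r) := by
    ext i j
    by_cases hj : j = k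
    · subst hj; simp [Matrix.mul_apply, Matrix.mulVec, dotProduct]
    · simp [Matrix.mul_apply, Matrix.updateCol_ne hj]
  rw [h1, ← Matrix.cramer_apply, Matrix.cramer_eq_adjugate_mulVec, lsCoeff, Matrix.inv_def,
    Ring.inverse_eq_inv', Matrix.smul_mulVec, Pi.smul_apply, smul_eq_mul, ← mul_assoc,
    mul_inv_cancel₀ h, one_mul]

/-- Cramer's rule and Cauchy–Schwarz remove the inverse: the volume-sampling density absorbs one
factor of the determinant, leaving a polynomial in the data that can be integrated exactly. -/
theorem det_mul_lsCoeff_sq_le {ι κ : Type*} [Fintype ι] [DecidableEq ι] [Fintype κ]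
    (Φ : Matrix κ ι ℝ) (r : κ → ℝ) (k : ι) :
    (Φᵀ * Φ).det * lsCoeff Φ r k ^ 2
      ≤ ((Φ.updateCol k r)ᵀ * Φ.updateCol k r).det := by
  by_cases h : (Φᵀ * Φ).det = 0
  · rw [h, zero_mul]; exact det_gram_nonneg _
  · have h1 := det_transpose_mul_sq_le Φ (Φ.updateCol k r)
    rw [← det_mul_lsCoeff Φ r] at h1
    have h2 : 0 < (Φᵀ * Φ).det := lt_of_le_of_ne (det_gram_nonneg _) (Ne.symm h)
    refine le_of_mul_le_mul_left ?_ h2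
    linarith

theorem gram_mulVec_lsCoeff {ι κ : Type*} [Fintype ι] [DecidableEq ι] [Fintype κ]
    (Φ : Matrix κ ι ℝ) (r : κ → ℝ) (h : (Φᵀ * Φ).det ≠ 0) :
    (Φᵀ * Φ) *ᵥ lsCoeff Φ r = Φᵀ *ᵥ r := by
  rw [lsCoeff, Matrix.mulVec_mulVec, Matrix.mul_nonsing_inv _ (isUnit_iff_ne_zero.2 h),
    Matrix.one_mulVec]

theorem dotProduct_gram_mulVec {ι κ : Type*} [Fintype ι] [Fintype κ]
    (Φ : Matrix κ ι ℝ) (z : ι → ℝ) :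
    z ⬝ᵥ (Φᵀ * Φ) *ᵥ z = (Φ *ᵥ z) ⬝ᵥ (Φ *ᵥ z) := by
  rw [← Matrix.mulVec_mulVec, Matrix.dotProduct_mulVec, Matrix.vecMul_transpose]

/-- The last factor is the Schur complement of the Gram block, that is, the residual sum of squares
of the fit. If the Gram block is singular, a kernel vector extended by zero is in the kernel of the
augmented matrix. -/
theorem det_gram_fromCols_eq {ι κ : Type*} [Fintype ι] [DecidableEq ι] [Fintype κ]
    (Φ : Matrix κ ι ℝ) (r : κ → ℝ) :
    ((fromCols Φ (replicateCol Unit r))ᵀ * fromCols Φ (replicateCol Unit r)).det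
      = (Φᵀ * Φ).det * (r ⬝ᵥ r - lsCoeff Φ r ⬝ᵥ (Φᵀ * Φ) *ᵥ lsCoeff Φ r) := by
  classical
  by_cases h : (Φᵀ * Φ).det = 0
  · rw [h, zero_mul]
    obtain ⟨v, hv, hv0⟩ := Matrix.exists_mulVec_eq_zero_iff.2 h
    have h1 : Φ *ᵥ v = 0 := by
      have := dotProduct_gram_mulVec Φ v
      rw [hv0, dotProduct_zero] at this
      exact dotProduct_self_eq_zero.1 this.symm
    refine Matrix.exists_mulVec_eq_zero_iff.1 ⟨Sum.elim v 0, ?_, ?_⟩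
    · intro h2
      exact hv (funext fun i => congrFun h2 (Sum.inl i))
    · rw [← Matrix.mulVec_mulVec, Matrix.fromCols_mulVec_sumElim, h1]
      simp
  · have := Matrix.invertibleOfIsUnitDet (Φᵀ * Φ) (isUnit_iff_ne_zero.2 h)
    rw [Matrix.transpose_fromCols, Matrix.fromRows_mul_fromCols, Matrix.det_fromBlocks₁₁,
      gram_mulVec_lsCoeff _ _ h, Matrix.invOf_eq_nonsing_inv]
    congr 1
    have h1 : Φᵀ * replicateCol Unit r = replicateCol Unit (Φᵀ *ᵥ r) :=
      (Matrix.replicateCol_mulVec _ _).symm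
    have h2 : (Φᵀ * Φ)⁻¹ * replicateCol Unit (Φᵀ *ᵥ r) = replicateCol Unit (lsCoeff Φ r) :=
      (Matrix.replicateCol_mulVec _ _).symm
    have h3 : (replicateCol Unit r)ᵀ * Φ = replicateRow Unit (Φᵀ *ᵥ r) := by
      rw [Matrix.transpose_replicateCol, ← Matrix.replicateRow_vecMul, ← Matrix.mulVec_transpose]
    rw [Matrix.mul_assoc _ (Φᵀ * Φ)⁻¹, h1, h2, h3, Matrix.transpose_replicateCol,
      Matrix.det_unique (n := Unit), Matrix.sub_apply, Matrix.replicateRow_mul_replicateCol_apply,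
      Matrix.replicateRow_mul_replicateCol_apply, dotProduct_comm (Φᵀ *ᵥ r)]

/-! ### Andréief identities: means of determinants over independent points. -/

/-- The matrix of the values of the functions `φ` at the points `x`. -/
def evalMatrix {ι κ X : Type*} (φ : ι → X → ℝ) (x : κ → X) : Matrix κ ι ℝ :=
  Matrix.of fun i j => φ j (x i)

/-- Injectivity of `g` means that each coordinate meets at most one of the factors `p k`, so the
integrand is a product over coordinates and Fubini applies. -/
theorem integral_prod_mul_prod_comp {ι κ X : Type*} [Fintype ι] [Fintype κ]
    [DecidableEq κ] [MeasurableSpace X] {ν : Measure X} [IsProbabilityMeasure ν]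
    {h : κ → X → ℝ} {p : ι → X → ℝ} {g : ι → κ} (hg : Function.Injective g)
    (hh : ∀ i, Integrable (h i) ν) (hp : ∀ k, Integrable (fun y => h (g k) y * p k y) ν) :
    Integrable (fun x : κ → X => (∏ i, h i (x i)) * ∏ k, p k (x (g k))) (Measure.pi fun _ => ν) ∧
    ∫ x : κ → X, (∏ i, h i (x i)) * ∏ k, p k (x (g k)) ∂(Measure.pi fun _ => ν)
      = (∏ i ∈ (Finset.univ.image g)ᶜ, ∫ y, h i y ∂ν) * ∏ k, ∫ y, h (g k) y * p k y ∂ν := by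
  set F : κ → X → ℝ := fun i y => h i y * ∏ k with g k = i, p k y with hF
  have hprod : ∀ x : κ → X, (∏ i, h i (x i)) * ∏ k, p k (x (g k)) = ∏ i, F i (x i) := by
    intro x
    rw [hF, Finset.prod_mul_distrib, ← Finset.prod_fiberwise Finset.univ g]
    congr 1
    refine Finset.prod_congr rfl fun i _ => Finset.prod_congr rfl fun k hk => ?_
    rw [(Finset.mem_filter.1 hk).2]
  have hin : ∀ k, F (g k) = fun y => h (g k) y * p k y := by
    intro k
    have : (Finset.univ.filter fun k' => g k' = g k) = {k} := by
      ext k'; simp [hg.eq_iff]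
    funext y
    simp only [hF, this, Finset.prod_singleton]
  have hout : ∀ i ∉ Finset.univ.image g, F i = h i := by
    intro i hi
    have : (Finset.univ.filter fun k' => g k' = i) = ∅ := by
      ext k'
      simp only [Finset.mem_image, Finset.mem_univ, true_and, not_exists] at hi
      simp [hi k']
    funext y
    simp only [hF, this, Finset.prod_empty, mul_one]
  have hint : ∀ i, Integrable (F i) ν := by
    intro i
    by_cases hi : i ∈ Finset.univ.image g
    · obtain ⟨k, -, rfl⟩ := Finset.mem_image.1 hi
      rw [hin k]; exact hp k
    · rw [hout i hi]; exact hh i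
  simp_rw [hprod]
  refine ⟨Integrable.fintype_prod hint, ?_⟩
  rw [integral_fintype_prod_eq_prod, ← Finset.prod_compl_mul_prod (Finset.univ.image g)]
  congr 1
  · refine Finset.prod_congr rfl fun i hi => ?_
    rw [hout i (Finset.mem_compl.1 hi)]
  · rw [Finset.prod_image fun a _ b _ hab => hg hab]
    exact Finset.prod_congr rfl fun k _ => by rw [hin k]

/-- The product-weighted **Andréief identity**. -/
theorem integral_prod_mul_det {ι κ X : Type*} [Fintype ι] [DecidableEq ι] [Fintype κ]
    [DecidableEq κ] [MeasurableSpace X] {ν : Measure X} [IsProbabilityMeasure ν]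
    {h : κ → X → ℝ} {φ ψ : ι → X → ℝ} (hh : ∀ i, Integrable (h i) ν)
    (hp : ∀ i k l, Integrable (fun y => h i y * (φ k y * ψ l y)) ν) :
    Integrable (fun x : κ → X => (∏ i, h i (x i)) * ((evalMatrix φ x)ᵀ * evalMatrix ψ x).det)
      (Measure.pi fun _ => ν) ∧
    ∫ x : κ → X, (∏ i, h i (x i)) * ((evalMatrix φ x)ᵀ * evalMatrix ψ x).det
        ∂(Measure.pi fun _ => ν)
      = ∑ g : ι ↪ κ, (∏ i ∈ (Finset.univ.image g)ᶜ, ∫ y, h i y ∂ν) *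
        (Matrix.of fun k l => ∫ y, h (g k) y * (φ k y * ψ l y) ∂ν).det := by
  have hpt : ∀ x : κ → X, (∏ i, h i (x i)) * ((evalMatrix φ x)ᵀ * evalMatrix ψ x).det
      = ∑ g : ι ↪ κ, ∑ σ : Equiv.Perm ι, ((Equiv.Perm.sign σ : ℤ) : ℝ) *
        ((∏ i, h i (x i)) * ∏ k, (φ k (x (g k)) * ψ (σ k) (x (g k)))) := by
    intro x
    have h1 : ∀ g : ι → κ, (∏ k, evalMatrix φ x (g k) k) * ((evalMatrix ψ x).submatrix g id).det
        = ∑ σ : Equiv.Perm ι, ((Equiv.Perm.sign σ : ℤ) : ℝ) *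
          ∏ k, (φ k (x (g k)) * ψ (σ k) (x (g k))) := by
      intro g
      rw [← Matrix.det_transpose, Matrix.det_apply', Finset.mul_sum]
      refine Finset.sum_congr rfl fun σ _ => ?_
      rw [Finset.prod_mul_distrib]
      simp only [evalMatrix, Matrix.transpose_apply, Matrix.submatrix_apply, Matrix.of_apply,
        id]
      ring
    have h2 : ((evalMatrix φ x)ᵀ * evalMatrix ψ x).det
        = ∑ g : ι ↪ κ, (∏ k, evalMatrix φ x (g k) k) *
          ((evalMatrix ψ x).submatrix g id).det := by
      rw [det_transpose_mul_eq_sum]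
      symm
      refine Finset.sum_of_injOn (fun g : ι ↪ κ => (g : ι → κ))
        (DFunLike.coe_injective.injOn) (by simp) ?_ (fun g _ => rfl)
      -- A selection with a repeated index gives a minor with two equal rows, so only embeddings
      -- contribute.
      intro g _ hg
      have hg' : ¬ Function.Injective g := fun hi => hg ⟨⟨g, hi⟩, by simp, rfl⟩
      simp only [Function.Injective, not_forall] at hg'
      obtain ⟨a, b, hab, hne⟩ := hg'
      rw [Matrix.det_zero_of_row_eq hne, mul_zero]
      funext l
      simp [hab]
    rw [h2, Finset.mul_sum]
    refine Finset.sum_congr rfl fun g _ => ?_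
    rw [h1, Finset.mul_sum]
    exact Finset.sum_congr rfl fun σ _ => by ring
  have key := fun (g : ι ↪ κ) (σ : Equiv.Perm ι) =>
    integral_prod_mul_prod_comp (ν := ν) (h := h) (p := fun k y => φ k y * ψ (σ k) y)
      g.injective hh fun k => hp _ _ _
  simp_rw [hpt]
  refine ⟨integrable_finsetSum _ fun g _ => integrable_finsetSum _ fun σ _ =>
    (key g σ).1.const_mul _, ?_⟩
  rw [integral_finsetSum _ fun g _ => integrable_finsetSum _ fun σ _ =>
    (key g σ).1.const_mul _]
  refine Finset.sum_congr rfl fun g _ => ?_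
  rw [integral_finsetSum _ fun σ _ => (key g σ).1.const_mul _, ← Matrix.det_transpose,
    Matrix.det_apply', Finset.mul_sum]
  refine Finset.sum_congr rfl fun σ _ => ?_
  rw [integral_const_mul, (key g σ).2]
  simp only [Matrix.transpose_apply, Matrix.of_apply]
  ring

/-- The **Andréief identity** for a sum of independent rank-one matrices. -/
theorem integral_det_transpose_mul {ι κ X : Type*} [Fintype ι] [DecidableEq ι] [Fintype κ]
    [MeasurableSpace X] {ν : Measure X} [IsProbabilityMeasure ν]
    {φ ψ : ι → X → ℝ} (hp : ∀ k l, Integrable (fun y => φ k y * ψ l y) ν) :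
    Integrable (fun x : κ → X => ((evalMatrix φ x)ᵀ * evalMatrix ψ x).det)
      (Measure.pi fun _ => ν) ∧
    ∫ x : κ → X, ((evalMatrix φ x)ᵀ * evalMatrix ψ x).det ∂(Measure.pi fun _ => ν)
      = ((Fintype.card κ).descFactorial (Fintype.card ι) : ℝ) *
        (Matrix.of fun k l => ∫ y, φ k y * ψ l y ∂ν).det := by
  classical
  have key := integral_prod_mul_det (κ := κ) (ν := ν) (h := fun _ _ => 1) (φ := φ) (ψ := ψ)
    (fun _ => integrable_const _) (fun _ => by simpa using hp)
  simpa [Fintype.card_embedding_eq] using key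

/-- The mean of `det(ΦᵀΦ) ∑ᵢ ρ(xᵢ)` over independent points, for orthonormal features. -/
theorem integral_det_gram_mul_sum {ι κ X : Type*} [Fintype ι] [DecidableEq ι] [Fintype κ]
    [MeasurableSpace X] {ν : Measure X} [IsProbabilityMeasure ν]
    {φ : ι → X → ℝ} {ρ : X → ℝ} (hφ : ∀ k l, Integrable (fun y => φ k y * φ l y) ν)
    (hφ1 : ∀ k l, ∫ y, φ k y * φ l y ∂ν = if k = l then 1 else 0)
    (hρ : Integrable ρ ν) (hρφ : ∀ k l, Integrable (fun y => ρ y * (φ k y * φ l y)) ν) :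
    Integrable (fun x : κ → X => ((evalMatrix φ x)ᵀ * evalMatrix φ x).det * ∑ i, ρ (x i))
      (Measure.pi fun _ => ν) ∧
    ∫ x : κ → X, ((evalMatrix φ x)ᵀ * evalMatrix φ x).det * ∑ i, ρ (x i)
        ∂(Measure.pi fun _ => ν)
      = ((Fintype.card κ).descFactorial (Fintype.card ι) : ℝ) *
        (((Fintype.card κ : ℝ) - Fintype.card ι) * ∫ y, ρ y ∂ν
          + ∑ k, ∫ y, ρ y * φ k y ^ 2 ∂ν) := by
  classical
  -- A single factor `ρ (x i₀)` is a product weight, equal to `1` away from `i₀`, so the weighted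
  -- identity applies to each summand.
  have hite : ∀ (i₀ : κ) (x : κ → X), ∏ i, (if i = i₀ then ρ (x i) else 1) = ρ (x i₀) := by
    intro i₀ x; simp
  have key : ∀ i₀ : κ, _ := fun i₀ => integral_prod_mul_det (κ := κ) (ν := ν)
    (h := fun i y => if i = i₀ then ρ y else 1) (φ := φ) (ψ := φ)
    (fun i => by by_cases hi : i = i₀ <;> simp [hi, hρ])
    (fun i k l => by by_cases hi : i = i₀ <;> simp [hi, hρφ, hφ])
  simp_rw [hite] at key
  have hsum : ∀ x : κ → X, ((evalMatrix φ x)ᵀ * evalMatrix φ x).det * ∑ i, ρ (x i)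
      = ∑ i, ρ (x i) * ((evalMatrix φ x)ᵀ * evalMatrix φ x).det := by
    intro x; rw [← Finset.sum_mul, mul_comm]
  simp_rw [hsum]
  refine ⟨integrable_finsetSum _ fun i _ => (key i).1, ?_⟩
  rw [integral_finsetSum _ fun i _ => (key i).1, Finset.sum_congr rfl fun i _ => (key i).2,
    Finset.sum_comm]
  -- If `i₀` is not selected, the weight contributes the mean of `ρ` and the matrix is the identity.
  -- If `i₀ = g k₀`, it changes only row `k₀` of the identity, and the determinant is that row's
  -- diagonal entry.
  have hterm : ∀ g : ι ↪ κ, ∑ i₀ : κ,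
      (∏ i ∈ (Finset.univ.image g)ᶜ, ∫ y, (if i = i₀ then ρ y else 1) ∂ν) *
        (Matrix.of fun k l => ∫ y, (if g k = i₀ then ρ y else 1) * (φ k y * φ l y) ∂ν).det
      = ((Fintype.card κ : ℝ) - Fintype.card ι) * ∫ y, ρ y ∂ν
          + ∑ k, ∫ y, ρ y * φ k y ^ 2 ∂ν := by
    intro g
    rw [← Finset.sum_compl_add_sum (Finset.univ.image g)]
    congr 1
    · have h1 : ∀ i₀ ∈ (Finset.univ.image g)ᶜ,
          (∏ i ∈ (Finset.univ.image g)ᶜ, ∫ y, (if i = i₀ then ρ y else 1) ∂ν) *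
          (Matrix.of fun k l => ∫ y, (if g k = i₀ then ρ y else 1) * (φ k y * φ l y) ∂ν).det
          = ∫ y, ρ y ∂ν := by
        intro i₀ hi₀
        have h2 : ∀ k, g k ≠ i₀ := by
          intro k hk
          exact Finset.mem_compl.1 hi₀ (Finset.mem_image.2 ⟨k, Finset.mem_univ _, hk⟩)
        have h3 : (Matrix.of fun k l => ∫ y, (if g k = i₀ then ρ y else 1) * (φ k y * φ l y) ∂ν)
            = 1 := by
          ext k l
          simp [h2, hφ1, Matrix.one_apply]
        have h4 : ∀ i, ∫ y, (if i = i₀ then ρ y else 1) ∂ν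
            = if i = i₀ then ∫ y, ρ y ∂ν else 1 := by
          intro i; by_cases hi : i = i₀ <;> simp [hi]
        simp_rw [h4]
        rw [h3, Matrix.det_one, mul_one, Finset.prod_ite_eq' _ i₀, if_pos hi₀]
      rw [Finset.sum_congr rfl h1, Finset.sum_const, nsmul_eq_mul, Finset.card_compl,
        Finset.card_image_of_injective _ g.injective, Finset.card_univ,
        Nat.cast_sub (Fintype.card_le_of_embedding g)]
    · rw [Finset.sum_image fun a _ b _ hab => g.injective hab]
      refine Finset.sum_congr rfl fun k₀ _ => ?_
      have h1 : ∏ i ∈ (Finset.univ.image g)ᶜ, ∫ y, (if i = g k₀ then ρ y else 1) ∂ν = 1 := by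
        refine Finset.prod_eq_one fun i hi => ?_
        have h2 : i ≠ g k₀ := by
          rintro rfl
          exact Finset.mem_compl.1 hi (Finset.mem_image.2 ⟨k₀, Finset.mem_univ _, rfl⟩)
        simp [h2]
      have h3 : (Matrix.of fun k l => ∫ y, (if g k = g k₀ then ρ y else 1) * (φ k y * φ l y) ∂ν)
          = (1 : Matrix ι ι ℝ).updateRow k₀ (fun l => ∫ y, ρ y * (φ k₀ y * φ l y) ∂ν) := by
        ext k l
        by_cases hk : k = k₀
        · subst hk; simp
        · simp [hk, hφ1, Matrix.one_apply]
      rw [h1, one_mul, h3, ← Matrix.det_transpose, ← Matrix.updateCol_transpose,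
        ← Matrix.cramer_apply, Matrix.transpose_one, Matrix.cramer_one]
      simp [pow_two]
  rw [Finset.sum_congr rfl fun g _ => hterm g]
  simp [Fintype.card_embedding_eq, mul_add]

/-! ### Spectral moments and rank-one perturbation of the resolvent. -/

/-- Simultaneous spectral representation of the moments and traces of the powers. -/
theorem exists_spectral_moments {ι : Type*} [Fintype ι] [DecidableEq ι] {S : Matrix ι ι ℝ}
    (hS : S.PosSemidef) :
    ∃ d : ι → ℝ, (∀ i, 0 ≤ d i) ∧ (∀ k : ℕ, (S ^ k).trace = ∑ i, d i ^ k) ∧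
      ∀ v : ι → ℝ, ∃ c : ι → ℝ, (∀ i, 0 ≤ c i) ∧
        ∀ k : ℕ, v ⬝ᵥ (S ^ k) *ᵥ v = ∑ i, c i * d i ^ k := by
  set U : Matrix ι ι ℝ := (hS.1.eigenvectorUnitary : Matrix ι ι ℝ)
  have hU : star U * U = 1 := Unitary.coe_star_mul_self _
  have hpow : ∀ k : ℕ, S ^ k = U * diagonal (fun i => hS.1.eigenvalues i ^ k) * star U := by
    intro k
    conv_lhs => rw [hS.1.spectral_theorem, ← map_pow, Matrix.diagonal_pow]
    rw [Unitary.conjStarAlgAut_apply]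
    rfl
  refine ⟨hS.1.eigenvalues, hS.eigenvalues_nonneg, ?_, ?_⟩
  · intro k
    rw [hpow, Matrix.trace_mul_comm, ← Matrix.mul_assoc, hU, Matrix.one_mul,
      Matrix.trace_diagonal]
  · intro v
    refine ⟨fun i => (star U *ᵥ v) i ^ 2, fun i => sq_nonneg _, fun k => ?_⟩
    rw [hpow, ← Matrix.mulVec_mulVec, ← Matrix.mulVec_mulVec, Matrix.dotProduct_mulVec]
    have : v ᵥ* U = star U *ᵥ v := by
      rw [Matrix.star_eq_conjTranspose, Matrix.conjTranspose_eq_transpose_of_trivial,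
        Matrix.mulVec_transpose]
    rw [this]
    simp only [dotProduct, Matrix.mulVec_diagonal]
    exact Finset.sum_congr rfl fun i _ => by ring

theorem moment_nonneg {ι : Type*} [Fintype ι] [DecidableEq ι] {S : Matrix ι ι ℝ}
    (hS : S.PosSemidef) (v : ι → ℝ) (k : ℕ) : 0 ≤ v ⬝ᵥ (S ^ k) *ᵥ v := by
  obtain ⟨d, hd, -, h⟩ := exists_spectral_moments hS
  obtain ⟨c, hc, h⟩ := h v
  rw [h]
  exact Finset.sum_nonneg fun i _ => mul_nonneg (hc i) (pow_nonneg (hd i) _)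

/-- Chebyshev's association inequality for the spectral measure with weights `c a * d a`: both `d ^
i` and `d ^ k` increase with `d`, so after symmetrizing in the two eigenvalues the difference is a
sum of nonnegative terms. -/
theorem moment_mul_moment_le {ι : Type*} [Fintype ι] [DecidableEq ι] {S : Matrix ι ι ℝ}
    (hS : S.PosSemidef) (v : ι → ℝ) (i k : ℕ) :
    (v ⬝ᵥ (S ^ (i + 1)) *ᵥ v) * (v ⬝ᵥ (S ^ (k + 1)) *ᵥ v)
      ≤ (v ⬝ᵥ S *ᵥ v) * (v ⬝ᵥ (S ^ (i + k + 1)) *ᵥ v) := by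
  obtain ⟨d, hd, -, h⟩ := exists_spectral_moments hS
  obtain ⟨c, hc, h⟩ := h v
  have h1 : v ⬝ᵥ S *ᵥ v = ∑ a, c a * d a ^ 1 := by rw [← h 1, pow_one]
  rw [h, h, h1, h, Finset.sum_mul_sum, Finset.sum_mul_sum]
  have e1 : ∀ F : ι → ι → ℝ, 2 * ∑ a, ∑ b, F a b = ∑ a, ∑ b, (F a b + F b a) := by
    intro F
    simp only [Finset.sum_add_distrib]
    rw [Finset.sum_comm (f := fun a b => F b a)]
    ring
  refine le_of_mul_le_mul_left ?_ (two_pos (α := ℝ))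
  rw [e1, e1]
  refine Finset.sum_le_sum fun a _ => Finset.sum_le_sum fun b _ => ?_
  have h2 : 0 ≤ (d a ^ i - d b ^ i) * (d a ^ k - d b ^ k) := by
    rcases le_total (d a) (d b) with hab | hab
    · exact mul_nonneg_of_nonpos_of_nonpos (sub_nonpos.2 (pow_le_pow_left₀ (hd a) hab i))
        (sub_nonpos.2 (pow_le_pow_left₀ (hd a) hab k))
    · exact mul_nonneg (sub_nonneg.2 (pow_le_pow_left₀ (hd b) hab i))
        (sub_nonneg.2 (pow_le_pow_left₀ (hd b) hab k))
  have h3 := mul_nonneg (mul_nonneg (mul_nonneg (hc a) (hc b)) (mul_nonneg (hd a) (hd b))) h2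
  have h4 : c a * d a ^ 1 * (c b * d b ^ (i + k + 1)) + c b * d b ^ 1 * (c a * d a ^ (i + k + 1))
      - (c a * d a ^ (i + 1) * (c b * d b ^ (k + 1)) + c b * d b ^ (i + 1) * (c a * d a ^ (k + 1)))
      = c a * c b * (d a * d b) * ((d a ^ i - d b ^ i) * (d a ^ k - d b ^ k)) := by
    ring
  linarith

theorem pow_eq_pow_add_sum {ι : Type*} [Fintype ι] [DecidableEq ι] (S R : Matrix ι ι ℝ) (p : ℕ) :
    S ^ p = R ^ p + ∑ j ∈ Finset.range p, R ^ j * (S - R) * S ^ (p - 1 - j) := by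
  induction p with
  | zero => simp
  | succ p ih =>
    rw [Finset.sum_range_succ]
    have h1 : ∀ j ∈ Finset.range p, R ^ j * (S - R) * S ^ (p + 1 - 1 - j)
        = R ^ j * (S - R) * S ^ (p - 1 - j) * S := by
      intro j hj
      have : p + 1 - 1 - j = p - 1 - j + 1 := by have := Finset.mem_range.1 hj; omega
      rw [this, pow_succ, Matrix.mul_assoc _ _ S]
    rw [Finset.sum_congr rfl h1, ← Finset.sum_mul, pow_succ, pow_succ]
    nth_rewrite 1 [ih]
    simp only [Nat.add_sub_cancel, Nat.sub_self, pow_zero, mul_one, add_mul, mul_sub]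
    abel

/-- With `u = B⁻¹ v`, expand `0 ≤ |v - a u|²` and use `a |u|² ≤ u · v`. -/
theorem moment_inv_le {ι : Type*} [Fintype ι] [DecidableEq ι] {B : Matrix ι ι ℝ}
    (hB : B.PosDef) {a : ℝ} (ha : 0 < a) (hBa : ∀ v : ι → ℝ, a * (v ⬝ᵥ v) ≤ v ⬝ᵥ B *ᵥ v)
    (v : ι → ℝ) : v ⬝ᵥ B⁻¹ *ᵥ v ≤ (v ⬝ᵥ v) / a := by
  have hdet : IsUnit B.det := (Matrix.isUnit_iff_isUnit_det B).1 hB.isUnit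
  set u := B⁻¹ *ᵥ v with hu
  have hBu : B *ᵥ u = v := by
    rw [hu, Matrix.mulVec_mulVec, Matrix.mul_nonsing_inv _ hdet, Matrix.one_mulVec]
  have h1 := hBa u
  rw [hBu] at h1
  have h2 : 0 ≤ (v - a • u) ⬝ᵥ (v - a • u) := by
    exact Finset.sum_nonneg fun i _ => mul_self_nonneg _
  have h3 : (v - a • u) ⬝ᵥ (v - a • u) = v ⬝ᵥ v - 2 * a * (u ⬝ᵥ v) + a ^ 2 * (u ⬝ᵥ u) := by
    simp only [sub_dotProduct, dotProduct_sub, smul_dotProduct, dotProduct_smul, smul_eq_mul,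
      dotProduct_comm v u]
    ring
  rw [dotProduct_comm v u, le_div_iff₀ ha]
  have h4 := mul_le_mul_of_nonneg_left h1 ha.le
  nlinarith

/-- Removing one rank-one term changes the moments of the resolvent by a factor at most `2`. -/
theorem moment_inv_le_two_mul {ι : Type*} [Fintype ι] [DecidableEq ι] {B : Matrix ι ι ℝ}
    (hB : B.PosDef) {a K : ℝ} (ha : 0 < a)
    (hBa : ∀ v : ι → ℝ, a * (v ⬝ᵥ v) ≤ v ⬝ᵥ B *ᵥ v)
    {v : ι → ℝ} (hv : v ⬝ᵥ v ≤ K) {p : ℕ} (hp : 2 * p * K ≤ a) :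
    v ⬝ᵥ (B⁻¹ ^ p) *ᵥ v ≤ 2 * (v ⬝ᵥ ((B + vecMulVec v v)⁻¹ ^ p) *ᵥ v) := by
  have hvv : (vecMulVec v v).PosSemidef := by
    simpa using Matrix.posSemidef_vecMulVec_self_star v
  have hB' : (B + vecMulVec v v).PosDef := hB.add_posSemidef hvv
  set S := B⁻¹ with hS
  set R := (B + vecMulVec v v)⁻¹ with hR
  have hSp : S.PosSemidef := hB.inv.posSemidef
  have hRp : R.PosSemidef := hB'.inv.posSemidef
  have hBS : B * S = 1 :=
    Matrix.mul_nonsing_inv _ ((Matrix.isUnit_iff_isUnit_det B).1 hB.isUnit)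
  have hRB : R * (B + vecMulVec v v) = 1 :=
    Matrix.nonsing_inv_mul _ ((Matrix.isUnit_iff_isUnit_det _).1 hB'.isUnit)
  -- Resolvent identity. The perturbation has rank one, so in `hrec` each telescoped term of `S ^ q
  -- - R ^ q` factors into a product of two scalar moments.
  have hdiff : S - R = R * vecMulVec v v * S := by
    have h1 : R * vecMulVec v v = 1 - R * B := by rw [← hRB, Matrix.mul_add]; abel
    rw [h1, Matrix.sub_mul, Matrix.one_mul, Matrix.mul_assoc, hBS, Matrix.mul_one]
  have hrec : ∀ q : ℕ, v ⬝ᵥ (S ^ q) *ᵥ v = v ⬝ᵥ (R ^ q) *ᵥ v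
      + ∑ j ∈ Finset.range q, (v ⬝ᵥ (R ^ (j + 1)) *ᵥ v) * (v ⬝ᵥ (S ^ (q - 1 - j + 1)) *ᵥ v) := by
    intro q
    conv_lhs => rw [pow_eq_pow_add_sum S R q]
    rw [Matrix.add_mulVec, dotProduct_add, Matrix.sum_mulVec, dotProduct_sum]
    congr 1
    refine Finset.sum_congr rfl fun j _ => ?_
    have h1 : R ^ j * (S - R) * S ^ (q - 1 - j)
        = R ^ (j + 1) * vecMulVec v v * S ^ (q - 1 - j + 1) := by
      rw [hdiff, pow_succ R, pow_succ' S]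
      simp only [Matrix.mul_assoc]
    rw [h1, ← Matrix.mulVec_mulVec, ← Matrix.mulVec_mulVec, Matrix.vecMulVec_mulVec]
    simp [Matrix.mulVec_smul, mul_comm]
  have hrs : ∀ q : ℕ, v ⬝ᵥ (R ^ q) *ᵥ v ≤ v ⬝ᵥ (S ^ q) *ᵥ v := by
    intro q
    rw [hrec q]
    exact le_add_of_nonneg_right (Finset.sum_nonneg fun j _ =>
      mul_nonneg (moment_nonneg hRp v _) (moment_nonneg hSp v _))
  have hs1 : v ⬝ᵥ S *ᵥ v ≤ K / a :=
    (moment_inv_le hB ha hBa v).trans (div_le_div_of_nonneg_right hv ha.le)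
  have hsp := moment_nonneg hSp v p
  -- Moments of `R` are at most those of `S`, and the association inequality collects each product
  -- into the first moment, at most `K / a`, times the moment of order `p`. Since `2 * p * K ≤ a`,
  -- the whole sum is at most half of that last moment and can be absorbed.
  have hsum : ∑ j ∈ Finset.range p,
      (v ⬝ᵥ (R ^ (j + 1)) *ᵥ v) * (v ⬝ᵥ (S ^ (p - 1 - j + 1)) *ᵥ v)
      ≤ ∑ j ∈ Finset.range p, (K / a) * (v ⬝ᵥ (S ^ p) *ᵥ v) := by
    refine Finset.sum_le_sum fun j hj => ?_
    have hj' := Finset.mem_range.1 hj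
    have h1 := moment_mul_moment_le hSp v j (p - 1 - j)
    have h2 : j + (p - 1 - j) + 1 = p := by omega
    rw [h2] at h1
    refine (mul_le_mul_of_nonneg_right (hrs _) (moment_nonneg hSp v _)).trans (h1.trans ?_)
    exact mul_le_mul_of_nonneg_right hs1 hsp
  rw [Finset.sum_const, Finset.card_range, nsmul_eq_mul] at hsum
  have h5 : (p : ℝ) * (K / a) ≤ 1 / 2 := by
    rw [← mul_div_assoc, div_le_iff₀ ha]; linarith
  have h6 := mul_le_mul_of_nonneg_right h5 hsp
  have h7 := hrec p
  nlinarith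

/-- A small value of the quadratic form forces a large trace of the powers of the inverse. -/
theorem one_le_pow_mul_trace_inv_pow {ι : Type*} [Fintype ι] [DecidableEq ι] {B : Matrix ι ι ℝ}
    (hB : B.PosDef) {t : ℝ} (ht : 0 < t) {v : ι → ℝ} (hv : v ⬝ᵥ B *ᵥ v < t * (v ⬝ᵥ v)) (p : ℕ) :
    1 ≤ t ^ p * (B⁻¹ ^ p).trace := by
  have hdet : IsUnit B.det := (Matrix.isUnit_iff_isUnit_det B).1 hB.isUnit
  obtain ⟨d, hd, htr, h⟩ := exists_spectral_moments hB.inv.posSemidef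
  obtain ⟨c, hc, h⟩ := h (B *ᵥ v)
  have hinv : B⁻¹ *ᵥ (B *ᵥ v) = v := by
    rw [Matrix.mulVec_mulVec, Matrix.nonsing_inv_mul _ hdet, Matrix.one_mulVec]
  have hsymm : (B⁻¹)ᵀ = B⁻¹ := by
    have := hB.inv.1
    rwa [Matrix.IsHermitian, Matrix.conjTranspose_eq_transpose_of_trivial] at this
  have h1 := h 1
  have h2 := h 2
  rw [pow_one, hinv, dotProduct_comm] at h1
  rw [pow_two, ← Matrix.mulVec_mulVec, hinv, Matrix.dotProduct_mulVec, ← hsymm,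
    Matrix.vecMul_transpose, hinv] at h2
  -- The spectral weights are taken at `B *ᵥ v`, so the first and second moments of `B⁻¹` are `v ⬝ᵥ
  -- B *ᵥ v` and `v ⬝ᵥ v`. Were all `t * d i` below `1`, comparing the two would contradict the
  -- assumed strict inequality.
  have hex : ∃ i, 1 ≤ t * d i := by
    by_contra! hcon
    have h3 : t * (v ⬝ᵥ v) ≤ v ⬝ᵥ B *ᵥ v := by
      rw [h1, h2, Finset.mul_sum]
      refine Finset.sum_le_sum fun i _ => ?_
      have := mul_le_mul_of_nonneg_left (hcon i).le (mul_nonneg (hc i) (hd i))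
      nlinarith
    linarith
  obtain ⟨i, hi⟩ := hex
  rw [htr]
  calc (1 : ℝ) ≤ (t * d i) ^ p := one_le_pow₀ hi
    _ = t ^ p * d i ^ p := mul_pow _ _ _
    _ ≤ t ^ p * ∑ j, d j ^ p := by
      refine mul_le_mul_of_nonneg_left ?_ (by positivity)
      exact Finset.single_le_sum (f := fun j => d j ^ p) (fun j _ => pow_nonneg (hd j) p)
        (Finset.mem_univ i)

/-! ### Measurability of matrix operations. -/

section Measurability

variable {α ι : Type*} [MeasurableSpace α] [Fintype ι]

theorem measurable_mul_apply {κ κ' : Type*} {M : α → Matrix κ ι ℝ} {N : α → Matrix ι κ' ℝ}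
    (hM : ∀ i j, Measurable fun x => M x i j) (hN : ∀ i j, Measurable fun x => N x i j)
    (i : κ) (j : κ') : Measurable fun x => (M x * N x) i j := by
  simp_rw [Matrix.mul_apply]
  exact Finset.measurable_fun_sum _ fun k _ => (hM _ _).mul (hN _ _)

variable [DecidableEq ι]

theorem measurable_det {M : α → Matrix ι ι ℝ} (hM : ∀ i j, Measurable fun x => M x i j) :
    Measurable fun x => (M x).det := by
  simp_rw [Matrix.det_apply']
  exact Finset.measurable_fun_sum _ fun σ _ =>
    (Finset.measurable_fun_prod _ fun i _ => hM _ _).const_mul _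

theorem measurable_inv_apply {M : α → Matrix ι ι ℝ} (hM : ∀ i j, Measurable fun x => M x i j)
    (i j : ι) : Measurable fun x => (M x)⁻¹ i j := by
  simp_rw [Matrix.inv_def, Ring.inverse_eq_inv', Matrix.smul_apply, Matrix.adjugate_apply,
    smul_eq_mul]
  refine (measurable_det hM).inv.mul (measurable_det fun a b => ?_)
  by_cases ha : a = j
  · subst ha; simp only [Matrix.updateRow_self]; exact measurable_const
  · simp only [Matrix.updateRow_ne ha]; exact hM a b

theorem measurable_pow_apply {M : α → Matrix ι ι ℝ} (hM : ∀ i j, Measurable fun x => M x i j)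
    (p : ℕ) (i j : ι) : Measurable fun x => (M x ^ p) i j := by
  induction p generalizing i j with
  | zero => simp only [pow_zero]; exact measurable_const
  | succ p ih => simp_rw [pow_succ]; exact measurable_mul_apply ih hM i j

end Measurability

/-! ### Negative moments of random Gram matrices. -/

/-- The regularized inverse `(ΦᵀΦ + a)⁻¹` of the Gram matrix of the features at the points `x`. -/
noncomputable def resolvent {ι κ X : Type*} [Fintype ι] [DecidableEq ι] [Fintype κ]
    (φ : ι → X → ℝ) (a : ℝ) (x : κ → X) : Matrix ι ι ℝ :=
  ((evalMatrix φ x)ᵀ * evalMatrix φ x + a • 1)⁻¹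

section Resolvent

theorem posSemidef_gram {ι κ X : Type*} [Fintype ι] [Fintype κ] (φ : ι → X → ℝ) (x : κ → X) :
    ((evalMatrix φ x)ᵀ * evalMatrix φ x).PosSemidef := by
  simpa using Matrix.posSemidef_conjTranspose_mul_self (evalMatrix φ x)

theorem gram_succAbove {ι X : Type*} (φ : ι → X → ℝ) {n : ℕ} (i : Fin (n + 1)) (x : Fin (n + 1) → X) :
    (evalMatrix φ x)ᵀ * evalMatrix φ x
      = (evalMatrix φ fun j => x (i.succAbove j))ᵀ * (evalMatrix φ fun j => x (i.succAbove j))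
        + vecMulVec (fun j => φ j (x i)) (fun j => φ j (x i)) := by
  ext k l
  simp [Matrix.mul_apply, evalMatrix, Fin.sum_univ_succAbove _ i, Matrix.vecMulVec_apply,
    add_comm]

theorem measurable_evalMatrix {ι κ X : Type*} [MeasurableSpace X] {φ : ι → X → ℝ} (hφ : ∀ j, Measurable (φ j)) (i : κ) (j : ι) :
    Measurable fun x : κ → X => evalMatrix φ x i j :=
  (hφ j).comp (measurable_pi_apply i)

variable {ι κ X : Type*} [Fintype ι] [DecidableEq ι] [Fintype κ]

theorem posDef_gram_add (φ : ι → X → ℝ) {a : ℝ} (ha : 0 < a) (x : κ → X) :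
    ((evalMatrix φ x)ᵀ * evalMatrix φ x + a • 1).PosDef :=
  Matrix.PosDef.posSemidef_add (posSemidef_gram φ x) (Matrix.PosDef.one.smul ha)

theorem posSemidef_resolvent (φ : ι → X → ℝ) {a : ℝ} (ha : 0 < a) (x : κ → X) :
    (resolvent φ a x).PosSemidef :=
  (posDef_gram_add φ ha x).inv.posSemidef

theorem mul_dotProduct_le_gram_add (φ : ι → X → ℝ) (a : ℝ) (x : κ → X) (v : ι → ℝ) :
    a * (v ⬝ᵥ v) ≤ v ⬝ᵥ ((evalMatrix φ x)ᵀ * evalMatrix φ x + a • 1) *ᵥ v := by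
  rw [Matrix.add_mulVec, dotProduct_add, dotProduct_gram_mulVec, Matrix.smul_mulVec,
    Matrix.one_mulVec, dotProduct_smul, smul_eq_mul]
  exact le_add_of_nonneg_left (Finset.sum_nonneg fun i _ => mul_self_nonneg _)

/-- The sum is the trace of `ΦᵀΦ R ^ (p + 1)`, and `ΦᵀΦ R = 1 - a R`; the term dropped has
nonnegative trace. -/
theorem sum_moment_resolvent_le (φ : ι → X → ℝ) {a : ℝ} (ha : 0 < a) (x : κ → X) (p : ℕ) :
    ∑ i, (fun j => φ j (x i)) ⬝ᵥ (resolvent φ a x ^ (p + 1)) *ᵥ (fun j => φ j (x i))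
      ≤ (resolvent φ a x ^ p).trace := by
  set E := evalMatrix φ x with hE
  set R := resolvent φ a x with hR
  have h1 : ∑ i, (fun j => φ j (x i)) ⬝ᵥ (R ^ (p + 1)) *ᵥ (fun j => φ j (x i))
      = (E * R ^ (p + 1) * Eᵀ).trace := by
    simp only [Matrix.trace, Matrix.diag]
    refine Finset.sum_congr rfl fun i _ => ?_
    rw [Matrix.mul_assoc]
    rfl
  have hinv : (Eᵀ * E + a • 1) * R = 1 :=
    Matrix.mul_nonsing_inv _
      ((Matrix.isUnit_iff_isUnit_det _).1 (posDef_gram_add φ ha x).isUnit)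
  have h2 : Eᵀ * (E * R ^ (p + 1)) = R ^ p - a • R ^ (p + 1) := by
    rw [eq_sub_iff_add_eq, ← Matrix.mul_assoc]
    calc Eᵀ * E * R ^ (p + 1) + a • R ^ (p + 1)
        = ((Eᵀ * E + a • 1) * R) * R ^ p := by
          rw [Matrix.mul_assoc _ R, ← pow_succ', Matrix.add_mul, Matrix.smul_mul, Matrix.one_mul,
            Matrix.mul_assoc]
      _ = R ^ p := by rw [hinv, Matrix.one_mul]
  rw [h1, Matrix.trace_mul_comm, h2, Matrix.trace_sub, Matrix.trace_smul, smul_eq_mul]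
  have h3 := ((posSemidef_resolvent φ ha x).pow (p + 1)).trace_nonneg
  have h4 := mul_nonneg ha.le h3
  exact sub_le_self _ h4

variable [MeasurableSpace X]

theorem measurable_resolvent_pow {φ : ι → X → ℝ} (hφ : ∀ j, Measurable (φ j)) (a : ℝ) (p : ℕ)
    (i j : ι) : Measurable fun x : κ → X => (resolvent φ a x ^ p) i j := by
  refine measurable_pow_apply (fun i j => measurable_inv_apply (fun i j => ?_) i j) p i j
  simp only [Matrix.add_apply]
  exact (measurable_mul_apply (M := fun x : κ → X => (evalMatrix φ x)ᵀ)
    (N := fun x : κ → X => evalMatrix φ x) (fun i j => measurable_evalMatrix hφ j i)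
    (measurable_evalMatrix hφ) i j).add measurable_const

theorem measurable_trace_resolvent_pow {φ : ι → X → ℝ} (hφ : ∀ j, Measurable (φ j)) (a : ℝ)
    (p : ℕ) : Measurable fun x : κ → X => (resolvent φ a x ^ p).trace :=
  Finset.measurable_fun_sum _ fun i _ => measurable_resolvent_pow hφ a p i i

/-- Orthonormality says that the mean of `φ φᵀ` is the identity. This lets a fresh sample point turn
a trace into a quadratic form. -/
theorem lintegral_moment_eq_trace {ν : Measure X} {φ : ι → X → ℝ}
    (hφi : ∀ k l, Integrable (fun y => φ k y * φ l y) ν)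
    (hφ1 : ∀ k l, ∫ y, φ k y * φ l y ∂ν = if k = l then 1 else 0) {M : Matrix ι ι ℝ}
    (hM : M.PosSemidef) :
    ∫⁻ y, ENNReal.ofReal ((fun j => φ j y) ⬝ᵥ M *ᵥ (fun j => φ j y)) ∂ν
      = ENNReal.ofReal M.trace := by
  have h1 : ∀ y, (fun j => φ j y) ⬝ᵥ M *ᵥ (fun j => φ j y)
      = ∑ k, ∑ l, M k l * (φ k y * φ l y) := by
    intro y
    simp only [dotProduct, Matrix.mulVec, Finset.mul_sum]
    exact Finset.sum_congr rfl fun k _ => Finset.sum_congr rfl fun l _ => by ring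
  have hint : Integrable (fun y => (fun j => φ j y) ⬝ᵥ M *ᵥ (fun j => φ j y)) ν := by
    simp_rw [h1]
    exact integrable_finsetSum _ fun k _ => integrable_finsetSum _ fun l _ =>
      (hφi k l).const_mul _
  rw [← ofReal_integral_eq_lintegral_ofReal hint (ae_of_all _ fun y => by
    simpa using hM.dotProduct_mulVec_nonneg (fun j => φ j y))]
  congr 1
  simp_rw [h1]
  have h2 : ∀ k l, Integrable (fun y => M k l * (φ k y * φ l y)) ν :=
    fun k l => (hφi k l).const_mul _
  rw [integral_finsetSum _ fun k _ => integrable_finsetSum _ fun l _ => h2 k l]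
  refine Finset.sum_congr rfl fun k _ => ?_
  rw [integral_finsetSum _ fun l _ => h2 k l]
  simp [integral_const_mul, hφ1]

/-- The exchangeability step of the matrix Chernoff bound. -/
theorem lintegral_trace_resolvent_pow_succ_le {ν : Measure X} [IsProbabilityMeasure ν]
    {φ : ι → X → ℝ} (hφ : ∀ j, Measurable (φ j))
    (hφi : ∀ k l, Integrable (fun y => φ k y * φ l y) ν)
    (hφ1 : ∀ k l, ∫ y, φ k y * φ l y ∂ν = if k = l then 1 else 0) {a K : ℝ} (ha : 0 < a)
    (hK : ∀ y, ∑ j, φ j y ^ 2 ≤ K) (n p : ℕ) (hp : 2 * (p + 1 : ℕ) * K ≤ a) :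
    ((n + 1 : ℕ) : ENNReal) * ∫⁻ x : Fin n → X, ENNReal.ofReal (resolvent φ a x ^ (p + 1)).trace
        ∂(Measure.pi fun _ => ν)
      ≤ 2 * ∫⁻ x : Fin (n + 1) → X, ENNReal.ofReal (resolvent φ a x ^ p).trace
        ∂(Measure.pi fun _ => ν) := by
  -- The point `x i` is independent of the other `n` points, so integrating it out of the
  -- leave-one-out quadratic form leaves a trace. All `n + 1` choices of `i` give the same value.
  have h1 : ∀ i : Fin (n + 1), ∫⁻ x : Fin n → X, ENNReal.ofReal (resolvent φ a x ^ (p + 1)).trace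
        ∂(Measure.pi fun _ => ν)
      = ∫⁻ x : Fin (n + 1) → X, ENNReal.ofReal ((fun j => φ j (x i)) ⬝ᵥ
          (resolvent φ a (fun j => x (i.succAbove j)) ^ (p + 1)) *ᵥ (fun j => φ j (x i)))
        ∂(Measure.pi fun _ => ν) := by
    intro i
    have hmp := measurePreserving_piFinSuccAbove (fun _ : Fin (n + 1) => ν) i
    have hmeas : Measurable fun z : X × (Fin n → X) => ENNReal.ofReal ((fun j => φ j z.1) ⬝ᵥ
        (resolvent φ a z.2 ^ (p + 1)) *ᵥ (fun j => φ j z.1)) := by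
      refine ENNReal.measurable_ofReal.comp ?_
      simp only [dotProduct, Matrix.mulVec]
      refine Finset.measurable_fun_sum _ fun k _ => ((hφ k).comp measurable_fst).mul ?_
      exact Finset.measurable_fun_sum _ fun l _ =>
        ((measurable_resolvent_pow hφ a (p + 1) k l).comp measurable_snd).mul
          ((hφ l).comp measurable_fst)
    have h2 := hmp.lintegral_comp hmeas
    rw [lintegral_prod_symm' _ hmeas] at h2
    refine Eq.trans ?_ h2.symm
    refine lintegral_congr fun x => ?_
    exact (lintegral_moment_eq_trace hφi hφ1 ((posSemidef_resolvent φ ha x).pow (p + 1))).symm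
  have hmeas : ∀ i : Fin (n + 1), Measurable fun x : Fin (n + 1) → X =>
      ENNReal.ofReal ((fun j => φ j (x i)) ⬝ᵥ
        (resolvent φ a (fun j => x (i.succAbove j)) ^ (p + 1)) *ᵥ (fun j => φ j (x i))) := by
    intro i
    refine ENNReal.measurable_ofReal.comp ?_
    simp only [dotProduct, Matrix.mulVec]
    refine Finset.measurable_fun_sum _ fun k _ => ((hφ k).comp (measurable_pi_apply i)).mul ?_
    refine Finset.measurable_fun_sum _ fun l _ => Measurable.mul ?_
      ((hφ l).comp (measurable_pi_apply i))
    exact (measurable_resolvent_pow hφ a (p + 1) k l).comp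
      (measurable_pi_lambda _ fun j => measurable_pi_apply _)
  have hsum : ((n + 1 : ℕ) : ENNReal) * ∫⁻ x : Fin n → X,
        ENNReal.ofReal (resolvent φ a x ^ (p + 1)).trace ∂(Measure.pi fun _ => ν)
      = ∑ i : Fin (n + 1), ∫⁻ x : Fin (n + 1) → X, ENNReal.ofReal ((fun j => φ j (x i)) ⬝ᵥ
          (resolvent φ a (fun j => x (i.succAbove j)) ^ (p + 1)) *ᵥ (fun j => φ j (x i)))
        ∂(Measure.pi fun _ => ν) := by
    rw [← Finset.sum_congr rfl fun i _ => h1 i, Finset.sum_const, Finset.card_univ,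
      Fintype.card_fin, nsmul_eq_mul]
  rw [hsum, ← lintegral_finsetSum _ fun i _ => hmeas i, ← lintegral_const_mul' _ _ (by simp)]
  refine lintegral_mono fun x => ?_
  have hnn : ∀ i : Fin (n + 1), 0 ≤ (fun j => φ j (x i)) ⬝ᵥ
      (resolvent φ a (fun j => x (i.succAbove j)) ^ (p + 1)) *ᵥ (fun j => φ j (x i)) :=
    fun i => moment_nonneg (posSemidef_resolvent φ ha _) _ _
  have h2' : (2 : ENNReal) = ENNReal.ofReal 2 := by simp
  rw [← ENNReal.ofReal_sum_of_nonneg fun i _ => hnn i, h2',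
    ← ENNReal.ofReal_mul (by norm_num)]
  refine ENNReal.ofReal_le_ofReal ?_
  refine le_trans (Finset.sum_le_sum fun i _ => ?_)
    ((Finset.mul_sum _ _ _).symm.le.trans
      (mul_le_mul_of_nonneg_left (sum_moment_resolvent_le φ ha x p) (by norm_num)))
  -- Putting `x i` back into the resolvent costs a factor `2`; the sum over `i` then closes up to a
  -- trace with one power less.
  have h3 := moment_inv_le_two_mul (posDef_gram_add φ ha fun j => x (i.succAbove j)) ha
    (mul_dotProduct_le_gram_add φ a _) (v := fun j => φ j (x i)) (K := K)
    (by simpa [dotProduct, pow_two] using hK (x i)) (p := p + 1) hp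
  rw [add_right_comm, ← gram_succAbove φ i x] at h3
  exact h3

/-- Induction on `p` with `n` free: every power is exchanged for one extra sample and a factor `2 /
(n + 1)`. The later factors have larger denominators, so they are bounded by the first. -/
theorem lintegral_trace_resolvent_pow_le_fin {ν : Measure X} [IsProbabilityMeasure ν]
    {φ : ι → X → ℝ} (hφ : ∀ j, Measurable (φ j))
    (hφi : ∀ k l, Integrable (fun y => φ k y * φ l y) ν)
    (hφ1 : ∀ k l, ∫ y, φ k y * φ l y ∂ν = if k = l then 1 else 0) {a K : ℝ} (ha : 0 < a)
    (hK0 : 0 ≤ K) (hK : ∀ y, ∑ j, φ j y ^ 2 ≤ K) (n p : ℕ) (hp : 2 * p * K ≤ a) :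
    ∫⁻ x : Fin n → X, ENNReal.ofReal (resolvent φ a x ^ p).trace ∂(Measure.pi fun _ => ν)
      ≤ ENNReal.ofReal (Fintype.card ι * (2 / (n + 1)) ^ p) := by
  induction p generalizing n with
  | zero => simp
  | succ p ih =>
    have h1 := lintegral_trace_resolvent_pow_succ_le hφ hφi hφ1 ha hK n p hp
    have hp' : 2 * p * K ≤ a := by
      refine le_trans ?_ hp
      push_cast
      nlinarith
    have h2 := h1.trans (mul_le_mul_right (ih (n + 1) hp') 2)
    have h4 : ENNReal.ofReal (Fintype.card ι * (2 / (n + 1)) ^ (p + 1))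
        = (2 * ENNReal.ofReal (Fintype.card ι * (2 / (n + 1)) ^ p)) / ((n + 1 : ℕ) : ENNReal) := by
      have h2' : (2 : ENNReal) = ENNReal.ofReal 2 := by simp
      rw [h2', ← ENNReal.ofReal_mul (by norm_num), ← ENNReal.ofReal_natCast,
        ← ENNReal.ofReal_div_of_pos (by positivity)]
      congr 1
      push_cast
      ring
    rw [h4, ENNReal.le_div_iff_mul_le (by simp) (by simp), mul_comm]
    refine h2.trans (mul_le_mul_right (ENNReal.ofReal_le_ofReal ?_) 2)
    push_cast
    gcongr
    linarith

/-- A matrix Chernoff bound for the lower tail, in terms of negative moments. -/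
theorem lintegral_trace_resolvent_pow_le {ν : Measure X} [IsProbabilityMeasure ν]
    {φ : ι → X → ℝ} (hφ : ∀ j, Measurable (φ j))
    (hφi : ∀ k l, Integrable (fun y => φ k y * φ l y) ν)
    (hφ1 : ∀ k l, ∫ y, φ k y * φ l y ∂ν = if k = l then 1 else 0) {a K : ℝ} (ha : 0 < a)
    (hK0 : 0 ≤ K) (hK : ∀ y, ∑ j, φ j y ^ 2 ≤ K) (p : ℕ) (hp : 2 * p * K ≤ a) :
    ∫⁻ x : κ → X, ENNReal.ofReal (resolvent φ a x ^ p).trace ∂(Measure.pi fun _ => ν)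
      ≤ ENNReal.ofReal (Fintype.card ι * (2 / (Fintype.card κ + 1)) ^ p) := by
  set e := (Fintype.equivFin κ).symm
  have hmp := measurePreserving_piCongrLeft (fun _ : κ => ν) e
  have hmeas : Measurable fun x : κ → X => ENNReal.ofReal (resolvent φ a x ^ p).trace :=
    ENNReal.measurable_ofReal.comp (measurable_trace_resolvent_pow hφ a p)
  rw [← hmp.lintegral_comp hmeas]
  refine le_trans (le_of_eq ?_) (lintegral_trace_resolvent_pow_le_fin hφ hφi hφ1 ha hK0 hK _ p hp)
  refine lintegral_congr fun x => ?_
  have h1 : resolvent φ a (MeasurableEquiv.piCongrLeft (fun _ : κ => X) e x)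
      = resolvent φ a x := by
    rw [resolvent, resolvent]
    congr 2
    ext k l
    simp only [Matrix.mul_apply, Matrix.transpose_apply, evalMatrix, Matrix.of_apply]
    refine (Fintype.sum_equiv e _ _ fun i => ?_).symm
    have : MeasurableEquiv.piCongrLeft (fun _ : κ => X) e x (e i) = x i :=
      Equiv.piCongrLeft_apply_apply (fun _ : κ => X) e x i
    rw [this]
  rw [h1]

end Resolvent

/-! ### Moments of the coefficients under volume sampling. -/

theorem evalMatrix_update {ι κ X : Type*} [DecidableEq ι] (φ : ι → X → ℝ) (k : ι) (r : X → ℝ)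
    (x : κ → X) :
    evalMatrix (Function.update φ k r) x = (evalMatrix φ x).updateCol k fun i => r (x i) := by
  ext i j
  by_cases hj : j = k
  · subst hj; simp [evalMatrix]
  · simp [evalMatrix, Matrix.updateCol_ne hj, Function.update_of_ne hj]

theorem evalMatrix_sumElim {ι κ X : Type*} (φ : ι → X → ℝ) (r : X → ℝ) (x : κ → X) :
    evalMatrix (Sum.elim φ fun _ : Unit => r) x
      = fromCols (evalMatrix φ x) (replicateCol Unit fun i => r (x i)) := by
  ext i j
  rcases j with j | j <;> simp [evalMatrix]

theorem det_mul_lsCoeff_sq_le_update {ι κ X : Type*} [Fintype ι] [DecidableEq ι] [Fintype κ]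
    (φ : ι → X → ℝ) (r : X → ℝ) (x : κ → X) (k : ι) :
    ((evalMatrix φ x)ᵀ * evalMatrix φ x).det *
      lsCoeff (evalMatrix φ x) (fun i => r (x i)) k ^ 2
      ≤ ((evalMatrix (Function.update φ k r) x)ᵀ * evalMatrix (Function.update φ k r) x).det := by
  rw [evalMatrix_update]
  exact det_mul_lsCoeff_sq_le _ _ k

theorem measurable_det_gram {ι κ X : Type*} [Fintype ι] [DecidableEq ι] [Fintype κ]
    [MeasurableSpace X] {φ : ι → X → ℝ} (hφ : ∀ j, Measurable (φ j)) :
    Measurable fun x : κ → X => ((evalMatrix φ x)ᵀ * evalMatrix φ x).det :=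
  measurable_det fun a b => measurable_mul_apply (M := fun x : κ → X => (evalMatrix φ x)ᵀ)
    (N := fun x : κ → X => evalMatrix φ x)
    (fun i j => measurable_evalMatrix hφ j i) (measurable_evalMatrix hφ) a b

/-- Bounded features that are orthonormal with respect to `ν`, together with a square integrable
residual `r` orthogonal to them. -/
structure IsDesign {ι X : Type*} [Fintype ι] [DecidableEq ι] [MeasurableSpace X] (ν : Measure X)
    (φ : ι → X → ℝ) (r : X → ℝ) (K : ℝ) : Prop where
  measurable : ∀ j, Measurable (φ j)
  measurable_res : Measurable r
  sum_sq_le : ∀ y, ∑ j, φ j y ^ 2 ≤ K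
  integral_mul : ∀ k l, ∫ y, φ k y * φ l y ∂ν = if k = l then 1 else 0
  integral_mul_res : ∀ k, ∫ y, φ k y * r y ∂ν = 0
  memLp_res : MemLp r 2 ν

namespace IsDesign

variable {ι κ X : Type*} [Fintype ι] [DecidableEq ι] [Fintype κ] [MeasurableSpace X]
  {ν : Measure X} {φ : ι → X → ℝ} {r : X → ℝ} {K : ℝ}

theorem abs_le (h : IsDesign ν φ r K) (j : ι) (y : X) : |φ j y| ≤ √K :=
  Real.abs_le_sqrt ((Finset.single_le_sum (f := fun j => φ j y ^ 2) (fun _ _ => sq_nonneg _)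
    (Finset.mem_univ j)).trans (h.sum_sq_le y))

theorem integrable_sq (h : IsDesign ν φ r K) : Integrable (fun y => r y ^ 2) ν :=
  h.memLp_res.integrable_sq

theorem measurable_update (h : IsDesign ν φ r K) (k j : ι) :
    Measurable (Function.update φ k r j) := by
  by_cases hj : j = k
  · subst hj; simpa using h.measurable_res
  · rw [Function.update_of_ne hj]; exact h.measurable j

theorem measurable_lsCoeff (h : IsDesign ν φ r K) (k : ι) :
    Measurable fun x : κ → X => lsCoeff (evalMatrix φ x) (fun i => r (x i)) k := by
  simp only [lsCoeff, Matrix.mulVec, dotProduct]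
  refine Finset.measurable_fun_sum _ fun l _ => Measurable.mul ?_ ?_
  · refine measurable_inv_apply (fun a b => ?_) k l
    exact measurable_mul_apply (M := fun x : κ → X => (evalMatrix φ x)ᵀ)
      (N := fun x : κ → X => evalMatrix φ x)
      (fun i j => measurable_evalMatrix h.measurable j i) (measurable_evalMatrix h.measurable) a b
  · exact Finset.measurable_fun_sum _ fun i _ => (measurable_evalMatrix h.measurable i l).mul
      (h.measurable_res.comp (measurable_pi_apply i))

theorem integrable_sq_mul (h : IsDesign ν φ r K) (k l : ι) :
    Integrable (fun y => r y ^ 2 * (φ k y * φ l y)) ν := by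
  refine Integrable.mul_bdd (c := √K * √K) h.integrable_sq
    ((h.measurable k).mul (h.measurable l)).aestronglyMeasurable (ae_of_all _ fun y => ?_)
  rw [Real.norm_eq_abs, abs_mul]
  exact mul_le_mul (h.abs_le k y) (h.abs_le l y) (abs_nonneg _) (Real.sqrt_nonneg _)

variable [IsProbabilityMeasure ν]

theorem bound_nonneg (h : IsDesign ν φ r K) : 0 ≤ K := by
  have : Nonempty X := ν.nonempty_of_neZero
  obtain ⟨y⟩ := this
  exact (Finset.sum_nonneg fun j _ => sq_nonneg (φ j y)).trans (h.sum_sq_le y)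

theorem memLp (h : IsDesign ν φ r K) (j : ι) : MemLp (φ j) 2 ν :=
  MemLp.of_bound (h.measurable j).aestronglyMeasurable (√K) (ae_of_all _ fun y => h.abs_le j y)

theorem integrable_mul (h : IsDesign ν φ r K) (k l : ι) :
    Integrable (fun y => φ k y * φ l y) ν :=
  (h.memLp k).integrable_mul (h.memLp l)

theorem memLp_update (h : IsDesign ν φ r K) (k j : ι) : MemLp (Function.update φ k r j) 2 ν := by
  by_cases hj : j = k
  · subst hj; simpa using h.memLp_res
  · rw [Function.update_of_ne hj]; exact h.memLp j

/-- The least-squares coefficients of the residual are unbiased under volume sampling. -/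
theorem integral_det_mul_lsCoeff (h : IsDesign ν φ r K) (k : ι) :
    Integrable (fun x : κ → X => ((evalMatrix φ x)ᵀ * evalMatrix φ x).det *
      lsCoeff (evalMatrix φ x) (fun i => r (x i)) k) (Measure.pi fun _ => ν) ∧
    ∫ x : κ → X, ((evalMatrix φ x)ᵀ * evalMatrix φ x).det *
      lsCoeff (evalMatrix φ x) (fun i => r (x i)) k ∂(Measure.pi fun _ => ν) = 0 := by
  simp_rw [det_mul_lsCoeff, ← evalMatrix_update]
  have key := integral_det_transpose_mul (κ := κ) (ν := ν) (φ := φ) (ψ := Function.update φ k r)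
    fun a b => (h.memLp a).integrable_mul (h.memLp_update k b)
  refine ⟨key.1, ?_⟩
  rw [key.2, Matrix.det_eq_zero_of_column_eq_zero k, mul_zero]
  intro a
  simpa using h.integral_mul_res a

/-- The residual is orthogonal to every feature, so exchanging it for the `k`-th one keeps the
system orthogonal; its Gram matrix is diagonal with one entry `∫ r²` and ones elsewhere. -/
theorem integral_det_gram_update (h : IsDesign ν φ r K) (k : ι) :
    Integrable (fun x : κ → X => ((evalMatrix (Function.update φ k r) x)ᵀ *
      evalMatrix (Function.update φ k r) x).det) (Measure.pi fun _ => ν) ∧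
    ∫ x : κ → X, ((evalMatrix (Function.update φ k r) x)ᵀ *
      evalMatrix (Function.update φ k r) x).det ∂(Measure.pi fun _ => ν)
      = ((Fintype.card κ).descFactorial (Fintype.card ι) : ℝ) * ∫ y, r y ^ 2 ∂ν := by
  have key := integral_det_transpose_mul (κ := κ) (ν := ν) (φ := Function.update φ k r)
    (ψ := Function.update φ k r) fun a b => (h.memLp_update k a).integrable_mul (h.memLp_update k b)
  refine ⟨key.1, ?_⟩
  have h1 : (Matrix.of fun a b => ∫ y, Function.update φ k r a y * Function.update φ k r b y ∂ν)
      = Matrix.diagonal (Function.update 1 k (∫ y, r y ^ 2 ∂ν)) := by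
    ext a b
    rw [Matrix.of_apply]
    by_cases ha : a = k
    · subst ha
      by_cases hb : b = a
      · subst hb; simp [pow_two]
      · rw [Matrix.diagonal_apply_ne _ (Ne.symm hb), Function.update_self,
          Function.update_of_ne hb]
        simp_rw [mul_comm (r _)]
        exact h.integral_mul_res b
    · rw [Function.update_of_ne ha]
      by_cases hb : b = k
      · subst hb
        rw [Matrix.diagonal_apply_ne _ ha, Function.update_self]
        exact h.integral_mul_res a
      · rw [Function.update_of_ne hb, h.integral_mul, Matrix.diagonal_apply,
          Function.update_of_ne ha, Pi.one_apply]
  rw [key.2, h1, Matrix.det_diagonal, Finset.prod_update_of_mem (Finset.mem_univ k)]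
  simp

theorem integrable_det_mul_sq (h : IsDesign ν φ r K) (k : ι) :
    Integrable (fun x : κ → X => ((evalMatrix φ x)ᵀ * evalMatrix φ x).det *
      lsCoeff (evalMatrix φ x) (fun i => r (x i)) k ^ 2) (Measure.pi fun _ => ν) := by
  refine (h.integral_det_gram_update (κ := κ) k).1.mono'
    ((measurable_det_gram h.measurable).mul ((h.measurable_lsCoeff k).pow_const 2)).aestronglyMeasurable
    (ae_of_all _ fun x => ?_)
  rw [Real.norm_eq_abs, abs_of_nonneg (mul_nonneg (det_gram_nonneg _) (sq_nonneg _))]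
  exact det_mul_lsCoeff_sq_le_update φ r x k

/-- A crude bound that requires no oversampling. It settles the regime `m ≤ ε`. -/
theorem integral_det_mul_sum_sq_le_card (h : IsDesign ν φ r K) :
    ∫ x : κ → X, ((evalMatrix φ x)ᵀ * evalMatrix φ x).det *
      ∑ k, lsCoeff (evalMatrix φ x) (fun i => r (x i)) k ^ 2 ∂(Measure.pi fun _ => ν)
      ≤ ((Fintype.card κ).descFactorial (Fintype.card ι) : ℝ) *
        (Fintype.card ι * ∫ y, r y ^ 2 ∂ν) := by
  simp_rw [Finset.mul_sum]
  rw [integral_finsetSum _ fun k _ => h.integrable_det_mul_sq k]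
  have h1 : ∀ k ∈ (Finset.univ : Finset ι), ∫ x : κ → X, ((evalMatrix φ x)ᵀ * evalMatrix φ x).det *
      lsCoeff (evalMatrix φ x) (fun i => r (x i)) k ^ 2 ∂(Measure.pi fun _ => ν)
      ≤ ((Fintype.card κ).descFactorial (Fintype.card ι) : ℝ) * ∫ y, r y ^ 2 ∂ν := by
    intro k _
    rw [← (h.integral_det_gram_update (κ := κ) k).2]
    exact integral_mono (h.integrable_det_mul_sq k) (h.integral_det_gram_update k).1
      fun x => det_mul_lsCoeff_sq_le_update φ r x k
  refine (Finset.sum_le_sum h1).trans (le_of_eq ?_)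
  rw [Finset.sum_const, Finset.card_univ, nsmul_eq_mul]
  ring

/-- The quadratic form is the energy of the data minus the residual sum of squares. Times the
determinant, the latter is the Gram determinant of the features augmented by `r`, so both parts have
exact means. Their leading terms `(n - m) ∫ r²` cancel, leaving `∑ ∫ r² φ_k²`, which the uniform
bound `K` controls. -/
theorem integral_det_mul_quadForm_le (h : IsDesign ν φ r K)
    (hcard : Fintype.card ι ≤ Fintype.card κ) :
    Integrable (fun x : κ → X => ((evalMatrix φ x)ᵀ * evalMatrix φ x).det *
      (lsCoeff (evalMatrix φ x) (fun i => r (x i)) ⬝ᵥ ((evalMatrix φ x)ᵀ * evalMatrix φ x) *ᵥ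
        lsCoeff (evalMatrix φ x) (fun i => r (x i)))) (Measure.pi fun _ => ν) ∧
    ∫ x : κ → X, ((evalMatrix φ x)ᵀ * evalMatrix φ x).det *
      (lsCoeff (evalMatrix φ x) (fun i => r (x i)) ⬝ᵥ ((evalMatrix φ x)ᵀ * evalMatrix φ x) *ᵥ
        lsCoeff (evalMatrix φ x) (fun i => r (x i))) ∂(Measure.pi fun _ => ν)
      ≤ ((Fintype.card κ).descFactorial (Fintype.card ι) : ℝ) * (K * ∫ y, r y ^ 2 ∂ν) := by
  set ψ : ι ⊕ Unit → X → ℝ := Sum.elim φ fun _ : Unit => r with hψ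
  have hψL : ∀ a, MemLp (ψ a) 2 ν := by
    rintro (a | a)
    · exact h.memLp a
    · exact h.memLp_res
  have key1 := integral_det_gram_mul_sum (κ := κ) h.integrable_mul h.integral_mul h.integrable_sq
    h.integrable_sq_mul
  have key2 := integral_det_transpose_mul (κ := κ) (ν := ν) (φ := ψ) (ψ := ψ)
    fun a b => (hψL a).integrable_mul (hψL b)
  have hgram : (Matrix.of fun a b => ∫ y, ψ a y * ψ b y ∂ν)
      = fromBlocks 1 0 0 (Matrix.of fun _ _ : Unit => ∫ y, r y ^ 2 ∂ν) := by
    ext a b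
    rcases a with a | a <;> rcases b with b | b
    · simp [hψ, h.integral_mul, Matrix.one_apply]
    · simp [hψ, h.integral_mul_res]
    · simp only [hψ, Matrix.of_apply, Sum.elim_inl, Sum.elim_inr, fromBlocks_apply₂₁,
        Matrix.zero_apply]
      simp_rw [mul_comm (r _)]
      exact h.integral_mul_res b
    · simp [hψ, pow_two]
  have hdet : (fromBlocks (1 : Matrix ι ι ℝ) 0 0
      (Matrix.of fun _ _ : Unit => ∫ y, r y ^ 2 ∂ν)).det = ∫ y, r y ^ 2 ∂ν := by
    rw [Matrix.det_fromBlocks_zero₂₁, Matrix.det_one, one_mul, Matrix.det_unique (n := Unit)]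
    rfl
  rw [hgram, hdet, Fintype.card_sum, Fintype.card_unit, Nat.descFactorial_succ] at key2
  have hpt : ∀ x : κ → X, ((evalMatrix φ x)ᵀ * evalMatrix φ x).det *
      (lsCoeff (evalMatrix φ x) (fun i => r (x i)) ⬝ᵥ ((evalMatrix φ x)ᵀ * evalMatrix φ x) *ᵥ
        lsCoeff (evalMatrix φ x) (fun i => r (x i)))
      = ((evalMatrix φ x)ᵀ * evalMatrix φ x).det * ∑ i, r (x i) ^ 2
        - ((evalMatrix ψ x)ᵀ * evalMatrix ψ x).det := by
    intro x
    have := det_gram_fromCols_eq (evalMatrix φ x) (fun i => r (x i))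
    rw [hψ, evalMatrix_sumElim, this]
    simp only [dotProduct, pow_two]
    ring
  simp_rw [hpt]
  refine ⟨key1.1.sub key2.1, ?_⟩
  rw [integral_sub key1.1 key2.1, key1.2, key2.2]
  have hsum : ∑ k, ∫ y, r y ^ 2 * φ k y ^ 2 ∂ν ≤ K * ∫ y, r y ^ 2 ∂ν := by
    have hi : ∀ k, Integrable (fun y => r y ^ 2 * φ k y ^ 2) ν := by
      intro k; simpa [pow_two (φ k _)] using h.integrable_sq_mul k k
    rw [← integral_finsetSum _ fun k _ => hi k, ← integral_const_mul]
    refine integral_mono (integrable_finsetSum _ fun k _ => hi k) (h.integrable_sq.const_mul K)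
      fun y => ?_
    simp only
    rw [← Finset.mul_sum, mul_comm]
    exact mul_le_mul_of_nonneg_right (h.sum_sq_le y) (sq_nonneg _)
  rw [Nat.cast_mul, Nat.cast_sub hcard]
  have h0 : (0 : ℝ) ≤ ((Fintype.card κ).descFactorial (Fintype.card ι) : ℝ) := Nat.cast_nonneg _
  have := mul_le_mul_of_nonneg_left hsum h0
  linarith

end IsDesign

/-! ### Splitting off the event of a badly conditioned Gram matrix. -/

/-- Functions of complementary groups of independent coordinates are independent. -/
theorem lintegral_pi_mul_eq {κ X : Type*} [Fintype κ] [MeasurableSpace X] {ν : Measure X}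
    [IsProbabilityMeasure ν] (T : κ → Prop) [DecidablePred T]
    {F : ({i // T i} → X) → ENNReal} {G : ({i // ¬ T i} → X) → ENNReal}
    (hF : Measurable F) (hG : Measurable G) :
    ∫⁻ x : κ → X, F (fun i => x i) * G (fun i => x i) ∂(Measure.pi fun _ => ν)
      = (∫⁻ x : κ → X, F (fun i => x i) ∂(Measure.pi fun _ => ν)) *
        ∫⁻ x, G x ∂(Measure.pi fun _ => ν) := by
  have hmp := measurePreserving_piEquivPiSubtypeProd (fun _ : κ => ν) T
  have h1 := hmp.lintegral_comp ((hF.comp measurable_fst).mul (hG.comp measurable_snd))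
  have h2 := hmp.lintegral_comp (hF.comp measurable_fst)
  rw [lintegral_prod _ (hF.comp measurable_fst).aemeasurable] at h2
  simp only [Function.comp_apply, lintegral_const, measure_univ, mul_one] at h2
  refine h1.trans ?_
  refine (lintegral_prod_mul hF.aemeasurable hG.aemeasurable).trans ?_
  rw [← h2]
  rfl

theorem gram_quadForm_subtype_le {ι κ X : Type*} [Fintype ι] [Fintype κ] (T : κ → Prop)
    [DecidablePred T] (φ : ι → X → ℝ) (x : κ → X) (z : ι → ℝ) :
    z ⬝ᵥ ((evalMatrix φ fun i : {i // T i} => x i)ᵀ * evalMatrix φ fun i : {i // T i} => x i) *ᵥ z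
      ≤ z ⬝ᵥ ((evalMatrix φ x)ᵀ * evalMatrix φ x) *ᵥ z := by
  rw [dotProduct_gram_mulVec, dotProduct_gram_mulVec]
  have h : ((evalMatrix φ fun i : {i // T i} => x i) *ᵥ z) ⬝ᵥ
      ((evalMatrix φ fun i : {i // T i} => x i) *ᵥ z)
      = ∑ i with T i, (evalMatrix φ x *ᵥ z) i * (evalMatrix φ x *ᵥ z) i :=
    (Finset.sum_subtype (Finset.univ.filter T) (by simp)
      (fun i => (evalMatrix φ x *ᵥ z) i * (evalMatrix φ x *ᵥ z) i)).symm
  rw [h]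
  exact Finset.sum_le_sum_of_subset_of_nonneg (Finset.filter_subset _ _)
    fun i _ _ => mul_self_nonneg _

/-- If the Gram matrix is small in the direction `z`, the trace of the powers of the resolvent of
any subset of the points is large. -/
theorem one_le_trace_resolvent_of_quadForm_lt {ι κ X : Type*} [Fintype ι] [DecidableEq ι]
    [Fintype κ] (T : κ → Prop) [DecidablePred T] (φ : ι → X → ℝ) (x : κ → X) {z : ι → ℝ}
    {a s : ℝ} (ha : 0 < a) (hs : 0 < s)
    (hz : z ⬝ᵥ ((evalMatrix φ x)ᵀ * evalMatrix φ x) *ᵥ z < s * (z ⬝ᵥ z)) (p : ℕ) :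
    1 ≤ (s + a) ^ p * (resolvent φ a (fun i : {i // T i} => x i) ^ p).trace := by
  refine one_le_pow_mul_trace_inv_pow (posDef_gram_add φ ha _) (by positivity) (v := z) ?_ p
  rw [Matrix.add_mulVec, dotProduct_add, Matrix.smul_mulVec, Matrix.one_mulVec, dotProduct_smul,
    smul_eq_mul]
  have := gram_quadForm_subtype_le T φ x z
  linarith

/-- Cauchy–Binet in the form needed for decoupling: the summand of `g` is nonnegative and depends
only on the points with index in the range of `g`. -/
theorem det_gram_eq_sum {ι κ X : Type*} [Fintype ι] [DecidableEq ι] [Fintype κ]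
    (ψ : ι → X → ℝ) (x : κ → X) :
    ((evalMatrix ψ x)ᵀ * evalMatrix ψ x).det
      = ∑ g : ι → κ, ((Fintype.card ι).factorial : ℝ)⁻¹ *
        (evalMatrix ψ fun k => x (g k)).det ^ 2 := by
  rw [← Finset.mul_sum, eq_inv_mul_iff_mul_eq₀ (by positivity), factorial_mul_det_transpose_mul]
  exact Finset.sum_congr rfl fun g _ => (pow_two _).symm

/-- Case split on whether the quadratic form at the coefficients reaches `s |z|²`. If not, every
Cauchy–Binet term is multiplied by a trace that is then at least `1` and involves only the
unselected points. -/
theorem det_mul_sum_sq_le {ι κ X : Type*} [Fintype ι] [DecidableEq ι] [Fintype κ]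
    [DecidableEq κ] (φ : ι → X → ℝ) (r : X → ℝ) {a s : ℝ} (ha : 0 < a)
    (hs : 0 < s) (p : ℕ) (x : κ → X) :
    ((evalMatrix φ x)ᵀ * evalMatrix φ x).det *
        ∑ k, lsCoeff (evalMatrix φ x) (fun i => r (x i)) k ^ 2
      ≤ s⁻¹ * (((evalMatrix φ x)ᵀ * evalMatrix φ x).det *
        (lsCoeff (evalMatrix φ x) (fun i => r (x i)) ⬝ᵥ ((evalMatrix φ x)ᵀ * evalMatrix φ x) *ᵥ
          lsCoeff (evalMatrix φ x) (fun i => r (x i))))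
      + ∑ k, ∑ g : ι → κ, ((Fintype.card ι).factorial : ℝ)⁻¹ *
        (evalMatrix (Function.update φ k r) fun l => x (g l)).det ^ 2 *
        ((s + a) ^ p *
          (resolvent φ a (fun i : {i // ¬ i ∈ Finset.univ.image g} => x i) ^ p).trace) := by
  set D := ((evalMatrix φ x)ᵀ * evalMatrix φ x).det
  set z := lsCoeff (evalMatrix φ x) (fun i => r (x i))
  have hD : 0 ≤ D := det_gram_nonneg _
  have hzz : ∑ k, z k ^ 2 = z ⬝ᵥ z := Finset.sum_congr rfl fun k _ => pow_two _
  have hfac : (0 : ℝ) ≤ ((Fintype.card ι).factorial : ℝ)⁻¹ := by positivity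
  rcases le_or_gt (s * (z ⬝ᵥ z)) (z ⬝ᵥ ((evalMatrix φ x)ᵀ * evalMatrix φ x) *ᵥ z) with h | h
  · refine le_add_of_le_of_nonneg ?_ ?_
    · rw [hzz, ← mul_assoc, mul_comm s⁻¹, mul_assoc]
      refine mul_le_mul_of_nonneg_left ?_ hD
      rwa [le_inv_mul_iff₀ hs]
    · refine Finset.sum_nonneg fun k _ => Finset.sum_nonneg fun g _ => ?_
      exact mul_nonneg (mul_nonneg hfac (sq_nonneg _)) (mul_nonneg (by positivity)
        ((posSemidef_resolvent φ ha _).pow p).trace_nonneg)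
  · refine le_add_of_nonneg_of_le ?_ ?_
    · refine mul_nonneg (by positivity) (mul_nonneg hD ?_)
      rw [dotProduct_gram_mulVec]
      exact Finset.sum_nonneg fun i _ => mul_self_nonneg _
    · rw [Finset.mul_sum]
      refine Finset.sum_le_sum fun k _ => ?_
      refine (det_mul_lsCoeff_sq_le_update φ r x k).trans ?_
      rw [det_gram_eq_sum]
      refine Finset.sum_le_sum fun g _ => ?_
      exact le_mul_of_one_le_right (mul_nonneg hfac (sq_nonneg _))
        (one_le_trace_resolvent_of_quadForm_lt (fun i => ¬ i ∈ Finset.univ.image g) φ x ha hs h p)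

namespace IsDesign

variable {ι κ X : Type*} [Fintype ι] [DecidableEq ι] [Fintype κ] [MeasurableSpace X]
  {ν : Measure X} {φ : ι → X → ℝ} {r : X → ℝ} {K : ℝ}

variable [IsProbabilityMeasure ν]

/-- Selected and unselected points are independent, so the integral factors. At least `n - m` points
are unselected whether or not `g` is injective, and the Chernoff bound applies to them. -/
theorem lintegral_det_sq_mul_trace_le [DecidableEq κ] (h : IsDesign ν φ r K)
    (hcard : Fintype.card ι ≤ Fintype.card κ) {a s : ℝ} (ha : 0 < a)
    (hs : 0 < s) {p : ℕ} (hp : 2 * p * K ≤ a) (k : ι) (g : ι → κ) :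
    ∫⁻ x : κ → X, ENNReal.ofReal (((Fintype.card ι).factorial : ℝ)⁻¹ *
        (evalMatrix (Function.update φ k r) fun l => x (g l)).det ^ 2 *
        ((s + a) ^ p *
          (resolvent φ a (fun i : {i // ¬ i ∈ Finset.univ.image g} => x i) ^ p).trace))
        ∂(Measure.pi fun _ => ν)
      ≤ (∫⁻ x : κ → X, ENNReal.ofReal (((Fintype.card ι).factorial : ℝ)⁻¹ *
        (evalMatrix (Function.update φ k r) fun l => x (g l)).det ^ 2)
          ∂(Measure.pi fun _ => ν)) *
        ENNReal.ofReal (Fintype.card ι *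
          ((s + a) * (2 / ((Fintype.card κ : ℝ) - Fintype.card ι + 1))) ^ p) := by
  have hfac : (0 : ℝ) ≤ ((Fintype.card ι).factorial : ℝ)⁻¹ := by positivity
  have hsa : 0 ≤ (s + a) ^ p := by positivity
  have hgm : ∀ l, g l ∈ Finset.univ.image g := fun l => Finset.mem_image_of_mem _ (Finset.mem_univ l)
  set F : ({i // i ∈ Finset.univ.image g} → X) → ENNReal := fun y =>
    ENNReal.ofReal (((Fintype.card ι).factorial : ℝ)⁻¹ *
      (evalMatrix (Function.update φ k r) fun l => y ⟨g l, hgm l⟩).det ^ 2) with hF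
  set G : ({i // ¬ i ∈ Finset.univ.image g} → X) → ENNReal := fun y =>
    ENNReal.ofReal ((s + a) ^ p * (resolvent φ a y ^ p).trace) with hG
  have hFm : Measurable F := by
    refine ENNReal.measurable_ofReal.comp (Measurable.const_mul (Measurable.pow_const ?_ 2) _)
    exact measurable_det fun i j => (h.measurable_update k j).comp (measurable_pi_apply _)
  have hGm : Measurable G :=
    ENNReal.measurable_ofReal.comp
      ((measurable_trace_resolvent_pow h.measurable a p).const_mul _)
  have h1 := lintegral_pi_mul_eq (ν := ν) (fun i => i ∈ Finset.univ.image g) hFm hGm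
  have h2 : ∀ x : κ → X, ENNReal.ofReal (((Fintype.card ι).factorial : ℝ)⁻¹ *
        (evalMatrix (Function.update φ k r) fun l => x (g l)).det ^ 2 *
        ((s + a) ^ p *
          (resolvent φ a (fun i : {i // ¬ i ∈ Finset.univ.image g} => x i) ^ p).trace))
      = F (fun i => x i) * G (fun i => x i) := by
    intro x
    rw [hF, hG, ENNReal.ofReal_mul (mul_nonneg hfac (sq_nonneg _))]
  simp_rw [h2]
  rw [h1]
  refine mul_le_mul_right ?_ _
  have h3 : ∫⁻ y, G y ∂(Measure.pi fun _ => ν) = ENNReal.ofReal ((s + a) ^ p) *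
      ∫⁻ y : {i // ¬ i ∈ Finset.univ.image g} → X, ENNReal.ofReal (resolvent φ a y ^ p).trace
        ∂(Measure.pi fun _ => ν) := by
    rw [← lintegral_const_mul' _ _ ENNReal.ofReal_ne_top]
    exact lintegral_congr fun y => ENNReal.ofReal_mul hsa
  rw [h3]
  refine (mul_le_mul_right (lintegral_trace_resolvent_pow_le h.measurable h.integrable_mul
    h.integral_mul ha h.bound_nonneg h.sum_sq_le p hp) _).trans ?_
  rw [← ENNReal.ofReal_mul hsa]
  refine ENNReal.ofReal_le_ofReal ?_
  rw [mul_pow, mul_left_comm]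
  have h4 : (Fintype.card κ : ℝ) - Fintype.card ι
      ≤ (Fintype.card {i // ¬ i ∈ Finset.univ.image g} : ℝ) := by
    rw [Fintype.card_subtype_compl, Fintype.card_coe, Nat.cast_sub (Finset.card_le_univ _)]
    have : (Finset.univ.image g).card ≤ Fintype.card ι := Finset.card_image_le
    have : ((Finset.univ.image g).card : ℝ) ≤ Fintype.card ι := by exact_mod_cast this
    linarith
  have h5 : (Fintype.card ι : ℝ) ≤ Fintype.card κ := by exact_mod_cast hcard
  have h6 : (0 : ℝ) < (Fintype.card κ : ℝ) - Fintype.card ι + 1 := by linarith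
  refine mul_le_mul_of_nonneg_left (mul_le_mul_of_nonneg_left ?_ hsa) (Nat.cast_nonneg _)
  refine pow_le_pow_left₀ (by positivity) ?_ p
  exact div_le_div_of_nonneg_left (by norm_num) h6 (by linarith)

/-- The second moment of the least-squares coefficients of the residual under volume sampling. -/
theorem integral_det_mul_sum_sq_le (h : IsDesign ν φ r K)
    (hcard : Fintype.card ι ≤ Fintype.card κ) {a s : ℝ} (ha : 0 < a)
    (hs : 0 < s) {p : ℕ} (hp : 2 * p * K ≤ a) :
    ∫ x : κ → X, ((evalMatrix φ x)ᵀ * evalMatrix φ x).det *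
      ∑ k, lsCoeff (evalMatrix φ x) (fun i => r (x i)) k ^ 2 ∂(Measure.pi fun _ => ν)
      ≤ ((Fintype.card κ).descFactorial (Fintype.card ι) : ℝ) *
        ((s⁻¹ * K + (Fintype.card ι : ℝ) ^ 2 *
          ((s + a) * (2 / ((Fintype.card κ : ℝ) - Fintype.card ι + 1))) ^ p) *
            ∫ y, r y ^ 2 ∂ν) := by
  classical
  set N : ℝ := ((Fintype.card κ).descFactorial (Fintype.card ι) : ℝ) with hN
  set q : ℝ := ((s + a) * (2 / ((Fintype.card κ : ℝ) - Fintype.card ι + 1))) ^ p with hq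
  set R2 : ℝ := ∫ y, r y ^ 2 ∂ν with hR2
  have hR20 : 0 ≤ R2 := integral_nonneg fun y => sq_nonneg _
  have hN0 : 0 ≤ N := Nat.cast_nonneg _
  have h5 : (Fintype.card ι : ℝ) ≤ Fintype.card κ := by exact_mod_cast hcard
  have h6 : (0 : ℝ) < (Fintype.card κ : ℝ) - Fintype.card ι + 1 := by linarith
  have hq0 : 0 ≤ q := by positivity
  have hfac : (0 : ℝ) ≤ ((Fintype.card ι).factorial : ℝ)⁻¹ := by positivity
  have hK0 := h.bound_nonneg
  obtain ⟨hQi, hQ⟩ := h.integral_det_mul_quadForm_le hcard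
  have hint : Integrable (fun x : κ → X => ((evalMatrix φ x)ᵀ * evalMatrix φ x).det *
      ∑ k, lsCoeff (evalMatrix φ x) (fun i => r (x i)) k ^ 2) (Measure.pi fun _ => ν) := by
    simp_rw [Finset.mul_sum]
    exact integrable_finsetSum _ fun k _ => h.integrable_det_mul_sq k
  have hnn : ∀ x : κ → X, 0 ≤ ((evalMatrix φ x)ᵀ * evalMatrix φ x).det *
      ∑ k, lsCoeff (evalMatrix φ x) (fun i => r (x i)) k ^ 2 := fun x =>
    mul_nonneg (det_gram_nonneg _) (Finset.sum_nonneg fun k _ => sq_nonneg _)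
  have hQnn : ∀ x : κ → X, 0 ≤ s⁻¹ * (((evalMatrix φ x)ᵀ * evalMatrix φ x).det *
      (lsCoeff (evalMatrix φ x) (fun i => r (x i)) ⬝ᵥ ((evalMatrix φ x)ᵀ * evalMatrix φ x) *ᵥ
        lsCoeff (evalMatrix φ x) (fun i => r (x i)))) := by
    intro x
    refine mul_nonneg (by positivity) (mul_nonneg (det_gram_nonneg _) ?_)
    rw [dotProduct_gram_mulVec]
    exact Finset.sum_nonneg fun i _ => mul_self_nonneg _
  set H : ι → (ι → κ) → (κ → X) → ℝ := fun k g x => ((Fintype.card ι).factorial : ℝ)⁻¹ *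
        (evalMatrix (Function.update φ k r) fun l => x (g l)).det ^ 2 with hH
  set W : ι → (ι → κ) → (κ → X) → ℝ := fun k g x => H k g x *
        ((s + a) ^ p *
          (resolvent φ a (fun i : {i // ¬ i ∈ Finset.univ.image g} => x i) ^ p).trace) with hW
  have hHnn : ∀ k g x, 0 ≤ H k g x := fun k g x => mul_nonneg hfac (sq_nonneg _)
  have hWnn : ∀ k g x, 0 ≤ W k g x := fun k g x =>
    mul_nonneg (hHnn k g x) (mul_nonneg (by positivity)
      ((posSemidef_resolvent φ ha _).pow p).trace_nonneg)
  have hHm : ∀ k g, Measurable (H k g) := fun k g =>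
    Measurable.const_mul (Measurable.pow_const (measurable_det fun i j =>
      (h.measurable_update k j).comp (measurable_pi_apply _)) 2) _
  have hWm : ∀ k g, Measurable (W k g) := fun k g =>
    (hHm k g).mul (Measurable.const_mul ((measurable_trace_resolvent_pow h.measurable a p).comp
      (measurable_pi_lambda _ fun i => measurable_pi_apply _)) _)
  -- After decoupling, the bound on the trace factor no longer depends on `g`, so the Cauchy–Binet
  -- terms can be summed back into one Gram determinant of known mean.
  have hHsum : ∀ k, ∑ g, ∫⁻ x, ENNReal.ofReal (H k g x) ∂(Measure.pi fun _ => ν)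
      = ENNReal.ofReal (N * R2) := by
    intro k
    have hk := h.integral_det_gram_update (κ := κ) k
    rw [← hk.2, ofReal_integral_eq_lintegral_ofReal hk.1 (ae_of_all _ fun x => det_gram_nonneg _),
      ← lintegral_finsetSum _ fun g _ => (hHm k g).ennreal_ofReal]
    refine lintegral_congr fun x => ?_
    rw [det_gram_eq_sum, ENNReal.ofReal_sum_of_nonneg fun g _ => hHnn k g x]
  have hmain : ∫⁻ x : κ → X, ENNReal.ofReal (((evalMatrix φ x)ᵀ * evalMatrix φ x).det *
      ∑ k, lsCoeff (evalMatrix φ x) (fun i => r (x i)) k ^ 2) ∂(Measure.pi fun _ => ν)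
      ≤ ENNReal.ofReal (s⁻¹ * (N * (K * R2)) + Fintype.card ι * (N * R2 * (Fintype.card ι * q))) := by
    calc _ ≤ ∫⁻ x : κ → X, (ENNReal.ofReal (s⁻¹ * (((evalMatrix φ x)ᵀ * evalMatrix φ x).det *
          (lsCoeff (evalMatrix φ x) (fun i => r (x i)) ⬝ᵥ ((evalMatrix φ x)ᵀ * evalMatrix φ x) *ᵥ
          lsCoeff (evalMatrix φ x) (fun i => r (x i)))))
          + ∑ k, ∑ g, ENNReal.ofReal (W k g x)) ∂(Measure.pi fun _ => ν) := by
          refine lintegral_mono fun x => ?_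
          refine (ENNReal.ofReal_le_ofReal (det_mul_sum_sq_le φ r ha hs p x)).trans ?_
          rw [ENNReal.ofReal_add (hQnn x) (Finset.sum_nonneg fun k _ =>
            Finset.sum_nonneg fun g _ => hWnn k g x),
            ENNReal.ofReal_sum_of_nonneg fun k _ => Finset.sum_nonneg fun g _ => hWnn k g x]
          refine add_le_add_right (le_of_eq (Finset.sum_congr rfl fun k _ => ?_)) _
          exact ENNReal.ofReal_sum_of_nonneg fun g _ => hWnn k g x
      _ = (∫⁻ x : κ → X, ENNReal.ofReal (s⁻¹ * (((evalMatrix φ x)ᵀ * evalMatrix φ x).det *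
          (lsCoeff (evalMatrix φ x) (fun i => r (x i)) ⬝ᵥ ((evalMatrix φ x)ᵀ * evalMatrix φ x) *ᵥ
          lsCoeff (evalMatrix φ x) (fun i => r (x i))))) ∂(Measure.pi fun _ => ν))
          + ∑ k, ∑ g, ∫⁻ x, ENNReal.ofReal (W k g x) ∂(Measure.pi fun _ => ν) := by
          rw [lintegral_add_right _ (Finset.measurable_fun_sum _ fun k _ =>
            Finset.measurable_fun_sum _ fun g _ => (hWm k g).ennreal_ofReal),
            lintegral_finsetSum _ fun k _ =>
              Finset.measurable_fun_sum _ fun g _ => (hWm k g).ennreal_ofReal]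
          congr 1
          exact Finset.sum_congr rfl fun k _ =>
            lintegral_finsetSum _ fun g _ => (hWm k g).ennreal_ofReal
      _ ≤ ENNReal.ofReal (s⁻¹ * (N * (K * R2)))
          + ∑ k : ι, ENNReal.ofReal (N * R2) * ENNReal.ofReal (Fintype.card ι * q) := by
          refine add_le_add ?_ (Finset.sum_le_sum fun k _ => ?_)
          · rw [← ofReal_integral_eq_lintegral_ofReal (hQi.const_mul _) (ae_of_all _ hQnn),
              integral_const_mul]
            exact ENNReal.ofReal_le_ofReal (mul_le_mul_of_nonneg_left hQ (by positivity))
          · rw [← hHsum k, Finset.sum_mul]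
            exact Finset.sum_le_sum fun g _ => h.lintegral_det_sq_mul_trace_le hcard ha hs hp k g
      _ = _ := by
          rw [Finset.sum_const, Finset.card_univ, nsmul_eq_mul,
            ← ENNReal.ofReal_mul (by positivity), ← ENNReal.ofReal_natCast,
            ← ENNReal.ofReal_mul (by positivity), ← ENNReal.ofReal_add (by positivity)
              (by positivity)]
  rw [← ofReal_integral_eq_lintegral_ofReal hint (ae_of_all _ hnn),
    ENNReal.ofReal_le_ofReal_iff (by positivity)] at hmain
  refine hmain.trans (le_of_eq ?_)
  ring

end IsDesign

/-! ### Choice of the parameters. -/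

/-- A sufficient oversampling constant. -/
noncomputable def oversampling (α ε₀ : ℝ) : ℝ :=
  32 / α * (4 + 4 * ε₀ ^ 2 + ε₀) + 2 * ε₀

/-- Here `a = s = n / 16` and `K = m / α`, and `p` is the largest integer with `2 p K ≤ a`. Each of
the two error terms is brought below `ε / 2`. The assumption `ε < m` makes the logarithm positive.
-/
theorem oversampling_bounds {α ε₀ ε : ℝ} (hα : 0 < α) (hε₀ : 0 < ε₀) (hε : 0 < ε) (hεε₀ : ε ≤ ε₀)
    {m n : ℕ} (hm : 1 ≤ m) (hmε : ε < m)
    (hn : oversampling α ε₀ * (m * Real.log (ε⁻¹ * m) + m * ε⁻¹) ≤ n) :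
    0 < (n : ℝ) ∧ 2 * (⌊α * n / (32 * m)⌋₊ : ℝ) * (m / α) ≤ n / 16 ∧
    ((n : ℝ) / 16)⁻¹ * (m / α) + (m : ℝ) ^ 2 *
      (((n : ℝ) / 16 + n / 16) * (2 / ((n : ℝ) - m + 1))) ^ ⌊α * n / (32 * m)⌋₊ ≤ ε := by
  set C := oversampling α ε₀ with hC
  set L := Real.log (ε⁻¹ * m) with hL
  set p := ⌊α * n / (32 * m)⌋₊ with hp
  have hm0 : (0 : ℝ) < m := by exact_mod_cast hm
  have hu : 0 < ε⁻¹ * m := by positivity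
  have hL0 : 0 < L := by
    refine Real.log_pos ?_
    rwa [inv_mul_eq_div, lt_div_iff₀ hε, one_mul]
  have hC0 : 0 < C := by rw [hC, oversampling]; positivity
  -- The three lower bounds on `C` serve, in turn, the term `s⁻¹ K`, the inequality `2 m ≤ n`, and
  -- the size of `p`.
  have hC1 : 32 / α ≤ C := by
    have h1 : 0 < 32 / α := by positivity
    rw [hC, oversampling]
    nlinarith [sq_nonneg ε₀]
  have hC2 : 2 * ε₀ ≤ C := by
    have h1 : 0 < 32 / α * (4 + 4 * ε₀ ^ 2 + ε₀) := by positivity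
    rw [hC, oversampling]
    linarith
  have hC3 : 4 + 4 * ε₀ ^ 2 + ε₀ ≤ α * C / 32 := by
    have h1 : α * C / 32 = (4 + 4 * ε₀ ^ 2 + ε₀) + α * ε₀ / 16 := by
      rw [hC, oversampling]; field_simp; ring
    have h2 : 0 < α * ε₀ / 16 := by positivity
    linarith
  have hinv : ε₀⁻¹ ≤ ε⁻¹ := inv_anti₀ hε hεε₀
  have hn' : C * (m * (L + ε⁻¹)) ≤ n := by rw [mul_add]; exact hn
  have hnε : C * (m * ε⁻¹) ≤ n := by
    refine le_trans ?_ hn'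
    gcongr
    linarith
  have hn2 : 2 * (m : ℝ) ≤ n := by
    refine le_trans ?_ hnε
    calc 2 * (m : ℝ) = 2 * ε₀ * (m * ε₀⁻¹) := by field_simp
      _ ≤ C * (m * ε⁻¹) := by gcongr
  have hn0 : (0 : ℝ) < n := by linarith
  have hy0 : 0 ≤ α * n / (32 * m) := by positivity
  refine ⟨hn0, ?_, ?_⟩
  · have h1 : (p : ℝ) ≤ α * n / (32 * m) := Nat.floor_le hy0
    calc 2 * (p : ℝ) * (m / α) ≤ 2 * (α * n / (32 * m)) * (m / α) := by gcongr
      _ = n / 16 := by field_simp; norm_num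
  · have h1 : ((n : ℝ) / 16)⁻¹ * (m / α) ≤ ε / 2 := by
      have h2 : 32 / α * (m * ε⁻¹) ≤ n := le_trans (by gcongr) hnε
      have h3 : 32 * m ≤ n * (α * ε) := by
        have h4 : 32 / α * (m * ε⁻¹) = 32 * m / (α * ε) := by field_simp
        rwa [h4, div_le_iff₀ (by positivity)] at h2
      have h5 : ((n : ℝ) / 16)⁻¹ * (m / α) = 16 * m / (n * α) := by field_simp
      rw [h5, div_le_iff₀ (by positivity)]
      linarith
    have h2 : (m : ℝ) ^ 2 * (((n : ℝ) / 16 + n / 16) * (2 / ((n : ℝ) - m + 1))) ^ p ≤ ε / 2 := by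
      have hd : (0 : ℝ) < n - m + 1 := by linarith
      have h3 : ((n : ℝ) / 16 + n / 16) * (2 / ((n : ℝ) - m + 1)) ≤ Real.exp (-(1 / 2)) := by
        have h4 : ((n : ℝ) / 16 + n / 16) * (2 / ((n : ℝ) - m + 1)) ≤ 1 / 2 := by
          rw [← mul_div_assoc, div_le_iff₀ hd]
          linarith
        have h5 := Real.add_one_le_exp (-(1 / 2) : ℝ)
        linarith
      have h4 : (((n : ℝ) / 16 + n / 16) * (2 / ((n : ℝ) - m + 1))) ^ p
          ≤ Real.exp (-(p / 2)) := by
        refine (pow_le_pow_left₀ (by positivity) h3 p).trans (le_of_eq ?_)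
        rw [← Real.exp_nat_mul]
        congr 1
        ring
      -- In `4 + 4 ε₀² + ε₀`, the first term supplies `4 L`; the other two, multiplied by `ε₀⁻¹`,
      -- supply `4 ε₀` and the `1` lost to the floor.
      have hy : 4 * L + 4 * ε₀ + 1 ≤ α * n / (32 * m) := by
        have h5 : α * C / 32 * (L + ε⁻¹) ≤ α * n / (32 * m) := by
          rw [le_div_iff₀ (by positivity)]
          have := mul_le_mul_of_nonneg_left hn' hα.le
          linarith
        refine le_trans ?_ h5
        have h6 : (4 + 4 * ε₀ ^ 2 + ε₀) * (L + ε₀⁻¹) ≤ α * C / 32 * (L + ε⁻¹) := by gcongr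
        refine le_trans ?_ h6
        have h7 : (4 + 4 * ε₀ ^ 2 + ε₀) * (L + ε₀⁻¹)
            = 4 * L + 4 * ε₀ + 1 + ((4 * ε₀ ^ 2 + ε₀) * L + 4 * ε₀⁻¹) := by
          field_simp; ring
        have h8 : 0 < (4 * ε₀ ^ 2 + ε₀) * L + 4 * ε₀⁻¹ := by positivity
        linarith
      have hpy : 4 * L + 4 * ε₀ ≤ p := by
        have := Nat.lt_floor_add_one (α * n / (32 * m))
        rw [← hp] at this
        linarith
      have h5 : Real.exp (-(p / 2)) ≤ Real.exp (-(2 * L)) * Real.exp (-(2 * ε₀)) := by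
        rw [← Real.exp_add, Real.exp_le_exp]
        linarith
      have h6 : Real.exp (-(2 * L)) = (ε / m) ^ 2 := by
        rw [Real.exp_neg, two_mul, Real.exp_add, hL, Real.exp_log hu]
        field_simp
      -- The factor `exp (-2 L)` gives `(ε / m)²`, one power of `ε` too many when `ε` is large; the
      -- extra `4 ε₀` in `p` compensates for it.
      have h7 : Real.exp (-(2 * ε₀)) ≤ (2 * ε)⁻¹ := by
        rw [Real.exp_neg]
        refine inv_anti₀ (by positivity) ?_
        have := Real.add_one_le_exp (2 * ε₀)
        linarith
      calc _ ≤ (m : ℝ) ^ 2 * ((ε / m) ^ 2 * (2 * ε)⁻¹) := by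
            refine mul_le_mul_of_nonneg_left (h4.trans (h5.trans ?_)) (by positivity)
            rw [h6]
            gcongr
        _ = ε / 2 := by field_simp
    linarith

/-- For `m ≤ ε` the logarithm is not positive and cannot control `p`, but then the crude bound by
`m` already suffices. -/
theorem IsDesign.integral_det_mul_sum_sq_le_of_oversampling {X : Type*} [MeasurableSpace X]
    {ν : Measure X} [IsProbabilityMeasure ν] {m n : ℕ} {φ : Fin m → X → ℝ} {r : X → ℝ}
    {α ε₀ ε : ℝ} (hα : 0 < α) (hε₀ : 0 < ε₀) (hε : 0 < ε) (hεε₀ : ε ≤ ε₀)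
    (h : IsDesign ν φ r (m / α)) (hm : 1 ≤ m) (hmn : m ≤ n)
    (hn : oversampling α ε₀ * (m * Real.log (ε⁻¹ * m) + m * ε⁻¹) ≤ n) :
    ∫ x : Fin n → X, ((evalMatrix φ x)ᵀ * evalMatrix φ x).det *
      ∑ k, lsCoeff (evalMatrix φ x) (fun i => r (x i)) k ^ 2 ∂(Measure.pi fun _ => ν)
      ≤ (n.descFactorial m : ℝ) * (ε * ∫ y, r y ^ 2 ∂ν) := by
  have hR : 0 ≤ ∫ y, r y ^ 2 ∂ν := integral_nonneg fun y => sq_nonneg _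
  rcases le_or_gt (m : ℝ) ε with hmε | hmε
  · refine (h.integral_det_mul_sum_sq_le_card (κ := Fin n)).trans ?_
    simp only [Fintype.card_fin]
    gcongr
  · obtain ⟨hn0, hp, hb⟩ := oversampling_bounds hα hε₀ hε hεε₀ hm hmε hn
    refine (h.integral_det_mul_sum_sq_le (κ := Fin n) (by simpa using hmn)
      (a := n / 16) (s := n / 16) (by positivity) (by positivity) hp).trans ?_
    simp only [Fintype.card_fin]
    gcongr

/-! ### Minimizers and the normal equations. -/

/-- By the normal equations the fitted residual is orthogonal to the columns, so Pythagoras forces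
`Φ (z₀ - z) = 0`; nonsingularity gives uniqueness. -/
theorem eq_lsCoeff_of_sum_sq_le {ι κ : Type*} [Fintype ι] [DecidableEq ι] [Fintype κ]
    {Φ : Matrix κ ι ℝ} {r : κ → ℝ} (h : (Φᵀ * Φ).det ≠ 0) {z : ι → ℝ}
    (hz : (r - Φ *ᵥ z) ⬝ᵥ (r - Φ *ᵥ z)
      ≤ (r - Φ *ᵥ lsCoeff Φ r) ⬝ᵥ (r - Φ *ᵥ lsCoeff Φ r)) : z = lsCoeff Φ r := by
  set z₀ := lsCoeff Φ r
  set e := r - Φ *ᵥ z₀ with he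
  have horth : ∀ v : ι → ℝ, e ⬝ᵥ (Φ *ᵥ v) = 0 := by
    intro v
    rw [Matrix.dotProduct_mulVec, ← Matrix.mulVec_transpose, he, Matrix.mulVec_sub,
      Matrix.mulVec_mulVec, gram_mulVec_lsCoeff Φ r h, sub_self, zero_dotProduct]
  have h1 : r - Φ *ᵥ z = e + Φ *ᵥ (z₀ - z) := by
    rw [he, Matrix.mulVec_sub]; abel
  rw [h1, add_dotProduct, dotProduct_add, dotProduct_add, horth, dotProduct_comm (Φ *ᵥ (z₀ - z)) e, horth] at hz
  have h2 : (Φ *ᵥ (z₀ - z)) ⬝ᵥ (Φ *ᵥ (z₀ - z)) = 0 :=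
    le_antisymm (by linarith) (Finset.sum_nonneg fun i _ => mul_self_nonneg _)
  have h3 : (Φᵀ * Φ) *ᵥ (z₀ - z) = 0 := by
    rw [← Matrix.mulVec_mulVec, dotProduct_self_eq_zero.1 h2, Matrix.mulVec_zero]
  have h4 : z₀ - z = 0 := by
    by_contra hne
    exact h (Matrix.exists_mulVec_eq_zero_iff.1 ⟨_, hne, h3⟩)
  exact (sub_eq_zero.1 h4).symm

/-- The least-squares projection of `f` is `P f` plus the least-squares fit of the residual. -/
theorem IsLeastSquaresProj.eq_l2Proj_add {X : Type*} [MeasurableSpace X] {μ : Measure X} {m n : ℕ}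
    {φ : Fin m → X → ℝ} {w f g : X → ℝ} {x : Fin n → X} (hn : 0 < n) (hw : ∀ y, 0 ≤ w y)
    (hdet : ((featureMatrix w φ x)ᵀ * featureMatrix w φ x).det ≠ 0)
    (hg : IsLeastSquaresProj w (approxSpace φ) x f g) :
    g = l2Proj μ φ f + ∑ k, lsCoeff (featureMatrix w φ x)
      (fun i => (√(w (x i)))⁻¹ * (f - l2Proj μ φ f) (x i)) k • φ k := by
  set ρ : Fin n → ℝ := fun i => (√(w (x i)))⁻¹ * (f - l2Proj μ φ f) (x i) with hρ
  have hn' : (0 : ℝ) < n := by exact_mod_cast hn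
  have hemp : ∀ z : Fin m → ℝ, empSqNorm w x (f - (l2Proj μ φ f + ∑ k, z k • φ k))
      = (1 / (n : ℝ)) * ((ρ - featureMatrix w φ x *ᵥ z) ⬝ᵥ (ρ - featureMatrix w φ x *ᵥ z)) := by
    intro z
    rw [empSqNorm]
    congr 1
    refine Finset.sum_congr rfl fun i _ => ?_
    have h1 : (ρ - featureMatrix w φ x *ᵥ z) i
        = (√(w (x i)))⁻¹ * (f - (l2Proj μ φ f + ∑ k, z k • φ k)) (x i) := by
      simp only [hρ, Pi.sub_apply, Pi.add_apply, Matrix.mulVec, dotProduct, featureMatrix,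
        Matrix.of_apply, Finset.sum_apply, Pi.smul_apply, smul_eq_mul]
      rw [← sub_sub, mul_sub _ _ (∑ k, _), Finset.mul_sum]
      congr 1
      exact Finset.sum_congr rfl fun k _ => by ring
    have h2 : (w (x i))⁻¹ = (√(w (x i)))⁻¹ * (√(w (x i)))⁻¹ := by
      rw [← mul_inv, Real.mul_self_sqrt (hw _)]
    rw [h1, h2]
    ring
  obtain ⟨hgV, hmin⟩ := hg
  obtain ⟨c, hc⟩ := (Submodule.mem_span_range_iff_exists_fun ℝ).1 hgV
  set z : Fin m → ℝ := fun k => c k - ∫ y, f y * φ k y ∂μ with hz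
  have hgz : g = l2Proj μ φ f + ∑ k, z k • φ k := by
    rw [← hc, l2Proj, ← Finset.sum_add_distrib]
    refine Finset.sum_congr rfl fun k _ => ?_
    rw [← add_smul, hz]
    congr 1
    ring
  have hmem : l2Proj μ φ f + ∑ k, lsCoeff (featureMatrix w φ x) ρ k • φ k ∈ approxSpace φ :=
    Submodule.add_mem _ (l2Proj_mem μ φ f) (Submodule.sum_mem _ fun k _ =>
      Submodule.smul_mem _ _ (Submodule.subset_span (Set.mem_range_self k)))
  have h1 := hmin _ hmem
  rw [hgz, hemp, hemp] at h1
  have h2 := eq_lsCoeff_of_sum_sq_le hdet (le_of_mul_le_mul_left h1 (by positivity))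
  rw [hgz, h2]

/-! ### Change of measure from `μ` to `ν = w μ`. -/

section Transfer

variable {X : Type*} [MeasurableSpace X] {μ : Measure X} {w : X → ℝ}

/-- The weights cancel the density except on `{w = 0}`, a `ν`-null set; the indicator records the
part of the `μ`-integral lost there. -/
theorem integral_densityMeasure_mul (hw : Measurable w) (hw0 : ∀ x, 0 ≤ w x) (g h : X → ℝ) :
    ∫ x, ((√(w x))⁻¹ * g x) * ((√(w x))⁻¹ * h x) ∂(densityMeasure μ w)
      = ∫ x, {x | w x ≠ 0}.indicator (fun x => g x * h x) x ∂μ := by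
  rw [densityMeasure, integral_withDensity_eq_integral_toReal_smul hw.ennreal_ofReal
    (ae_of_all _ fun x => ENNReal.ofReal_lt_top)]
  refine integral_congr_ae (ae_of_all _ fun x => ?_)
  simp only [ENNReal.toReal_ofReal (hw0 x), smul_eq_mul]
  by_cases h0 : w x = 0
  · simp [h0]
  · have h1 : √(w x) ≠ 0 := (Real.sqrt_pos.2 (lt_of_le_of_ne (hw0 x) (Ne.symm h0))).ne'
    rw [Set.indicator_of_mem (by exact h0)]
    nth_rewrite 1 [← Real.mul_self_sqrt (hw0 x)]
    field_simp

theorem densityMeasure_absolutelyContinuous (μ : Measure X) (w : X → ℝ) :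
    densityMeasure μ w ≪ μ :=
  withDensity_absolutelyContinuous _ _

theorem aestronglyMeasurable_weighted (hw : Measurable w) {g : X → ℝ}
    (hg : AEStronglyMeasurable g μ) :
    AEStronglyMeasurable (fun x => (√(w x))⁻¹ * g x) (densityMeasure μ w) :=
  (hw.sqrt.inv.aestronglyMeasurable).mul
    (hg.mono_ac (densityMeasure_absolutelyContinuous μ w))

theorem memLp_weighted (hw : Measurable w) (hw0 : ∀ x, 0 ≤ w x) {g : X → ℝ} (hg : MemLp g 2 μ) :
    MemLp (fun x => (√(w x))⁻¹ * g x) 2 (densityMeasure μ w) := by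
  rw [memLp_two_iff_integrable_sq (aestronglyMeasurable_weighted hw hg.1), densityMeasure,
    integrable_withDensity_iff_integrable_smul' hw.ennreal_ofReal
      (ae_of_all _ fun x => ENNReal.ofReal_lt_top)]
  have h1 : (fun x => (ENNReal.ofReal (w x)).toReal • ((√(w x))⁻¹ * g x) ^ 2)
      = {x | w x ≠ 0}.indicator fun x => g x ^ 2 := by
    funext x
    simp only [ENNReal.toReal_ofReal (hw0 x), smul_eq_mul]
    by_cases h0 : w x = 0
    · simp [h0]
    · rw [Set.indicator_of_mem (by exact h0), mul_pow, inv_pow, Real.sq_sqrt (hw0 x)]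
      field_simp
  rw [h1]
  exact hg.integrable_sq.indicator (hw (measurableSet_singleton 0).compl)

/-- Weighted functions are only a.e. measurable and a.e. bounded. Good representatives are chosen so
that the previous sections can assume both properties everywhere. -/
theorem exists_isDesign {m : ℕ} {φ : Fin m → X → ℝ} {f : X → ℝ} {α : ℝ} (hα : 0 < α)
    (hm : 1 ≤ m) (hφ : IsOrthonormalSystem μ φ) (hw : Measurable w) (hw0 : ∀ x, 0 ≤ w x)
    (hαw : ∀ᵐ x ∂μ, α * optDensity φ x ≤ w x) (hf : MemLp f 2 μ) :
    ∃ (ψ : Fin m → X → ℝ) (r : X → ℝ), IsDesign (densityMeasure μ w) ψ r (m / α) ∧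
      (∀ j, ∀ᵐ x ∂(densityMeasure μ w), ψ j x = (√(w x))⁻¹ * φ j x) ∧
      (∀ᵐ x ∂(densityMeasure μ w), r x = (√(w x))⁻¹ * (f - l2Proj μ φ f) x) ∧
      ∫ x, r x ^ 2 ∂(densityMeasure μ w) ≤ sqNorm μ (f - l2Proj μ φ f) := by
  have hm0 : (0 : ℝ) < m := by exact_mod_cast hm
  have hac := densityMeasure_absolutelyContinuous μ w
  set ρ := f - l2Proj μ φ f with hρ
  have hρL : MemLp ρ 2 μ := hf.sub (memLp_of_mem hφ (l2Proj_mem μ φ f))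
  have hsum : ∀ᵐ x ∂μ, ∑ j, φ j x ^ 2 ≤ (m / α) * w x := by
    filter_upwards [hαw] with x hx
    rw [optDensity] at hx
    rw [div_mul_eq_mul_div, le_div_iff₀ hα]
    have := mul_le_mul_of_nonneg_left hx hm0.le
    calc (∑ j, φ j x ^ 2) * α = m * (α * (1 / m * ∑ j, φ j x ^ 2)) := by field_simp
      _ ≤ m * w x := this
  have hφm := fun j => aestronglyMeasurable_weighted hw (hφ.memLp j).1
  have hrm := aestronglyMeasurable_weighted hw hρL.1
  set ψ₀ : Fin m → X → ℝ := fun j => (hφm j).mk _ with hψ₀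
  have hψ₀m : ∀ j, Measurable (ψ₀ j) := fun j => (hφm j).stronglyMeasurable_mk.measurable
  -- Truncating outside this set of full `ν`-measure makes the bound `m / α` hold pointwise.
  set G : Set X := {x | ∑ j, ψ₀ j x ^ 2 ≤ m / α} with hG
  have hGm : MeasurableSet G :=
    measurableSet_le (Finset.measurable_fun_sum _ fun j _ => (hψ₀m j).pow_const 2) measurable_const
  have hψ₀e : ∀ᵐ x ∂(densityMeasure μ w), ∀ j, ψ₀ j x = (√(w x))⁻¹ * φ j x :=
    ae_all_iff.2 fun j => (hφm j).ae_eq_mk.symm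
  have hGae : ∀ᵐ x ∂(densityMeasure μ w), x ∈ G := by
    filter_upwards [hψ₀e, hac.ae_le hsum] with x hx hs
    rw [hG, Set.mem_ofPred_eq]
    simp_rw [hx, mul_pow, inv_pow, Real.sq_sqrt (hw0 x)]
    rw [← Finset.mul_sum]
    rcases (hw0 x).eq_or_lt with h0 | h0
    · rw [← h0, _root_.inv_zero, zero_mul]; positivity
    · rw [inv_mul_le_iff₀ h0, mul_comm]; exact hs
  set ψ : Fin m → X → ℝ := fun j => G.indicator (ψ₀ j) with hψ
  set r : X → ℝ := hrm.mk _ with hr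
  have hψe : ∀ j, ∀ᵐ x ∂(densityMeasure μ w), ψ j x = (√(w x))⁻¹ * φ j x := by
    intro j
    filter_upwards [hψ₀e, hGae] with x hx hxG
    rw [hψ]; simp only [Set.indicator_of_mem hxG]; exact hx j
  have hre : ∀ᵐ x ∂(densityMeasure μ w), r x = (√(w x))⁻¹ * ρ x := hrm.ae_eq_mk.symm
  -- The lower bound on `w` makes all features vanish where `w` does, so nothing is lost in
  -- integrals against a feature.
  have hzero : ∀ᵐ x ∂μ, w x = 0 → ∀ j, φ j x = 0 := by
    filter_upwards [hsum] with x hx h0 j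
    rw [h0, mul_zero] at hx
    have h1 := (Finset.sum_eq_zero_iff_of_nonneg fun j _ => sq_nonneg (φ j x)).1
      (le_antisymm hx (Finset.sum_nonneg fun j _ => sq_nonneg _)) j (Finset.mem_univ j)
    exact (pow_eq_zero_iff two_ne_zero).1 h1
  have hint : ∀ (k : Fin m) (g : X → ℝ),
      ∫ x, ((√(w x))⁻¹ * φ k x) * ((√(w x))⁻¹ * g x) ∂(densityMeasure μ w)
        = ∫ x, φ k x * g x ∂μ := by
    intro k g
    rw [integral_densityMeasure_mul hw hw0]
    refine integral_congr_ae ?_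
    filter_upwards [hzero] with x hx
    by_cases h0 : w x = 0
    · simp [h0, hx h0 k]
    · rw [Set.indicator_of_mem (by exact h0)]
  refine ⟨ψ, r, ⟨fun j => (hψ₀m j).indicator hGm, hrm.stronglyMeasurable_mk.measurable, ?_, ?_, ?_,
    (memLp_congr_ae hre).2 (memLp_weighted hw hw0 hρL)⟩, hψe, hre, ?_⟩
  · intro y
    by_cases hy : y ∈ G
    · simp only [hψ, Set.indicator_of_mem hy]; exact hy
    · simp only [hψ, Set.indicator_of_notMem hy]
      simp only [ne_eq, OfNat.ofNat_ne_zero, not_false_eq_true, zero_pow, Finset.sum_const_zero]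
      positivity
  · intro k l
    rw [← hφ.integral_mul k l, ← hint k (φ l)]
    refine integral_congr_ae ?_
    filter_upwards [hψe k, hψe l] with x h1 h2
    rw [h1, h2]
  · intro k
    rw [← integral_sub_l2Proj_mul hφ hf (g := φ k) (Submodule.subset_span (Set.mem_range_self k))]
    have h1 : ∫ x, (f x - l2Proj μ φ f x) * φ k x ∂μ = ∫ x, φ k x * ρ x ∂μ :=
      integral_congr_ae (ae_of_all _ fun x => mul_comm _ _)
    rw [h1, ← hint k ρ]
    refine integral_congr_ae ?_
    filter_upwards [hψe k, hre] with x h1 h2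
    rw [h1, h2]
  · have h1 : ∫ x, r x ^ 2 ∂(densityMeasure μ w)
        = ∫ x, ((√(w x))⁻¹ * ρ x) * ((√(w x))⁻¹ * ρ x) ∂(densityMeasure μ w) := by
      refine integral_congr_ae ?_
      filter_upwards [hre] with x h1
      rw [h1, pow_two]
    rw [h1, integral_densityMeasure_mul hw hw0, sqNorm]
    -- Only an inequality: the residual, unlike the features, may have mass on `{w = 0}`.
    refine integral_mono_of_nonneg (ae_of_all _ fun x => ?_) hρL.integrable_sq
      (ae_of_all _ fun x => ?_)
    · exact Set.indicator_nonneg (fun x _ => mul_self_nonneg _) x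
    · refine (Set.indicator_le_self' (fun x _ => mul_self_nonneg _) x).trans (le_of_eq ?_)
      simp only [pow_two]

theorem ae_pi_forall {n : ℕ} {ν : Measure X} [IsProbabilityMeasure ν] {p : X → Prop}
    (h : ∀ᵐ y ∂ν, p y) : ∀ᵐ x ∂(Measure.pi fun _ : Fin n => ν), ∀ i, p (x i) :=
  ae_all_iff.2 fun i => (Measure.tendsto_eval_ae_ae (μ := fun _ : Fin n => ν) (i := i)).eventually h

/-- The coefficients of the error of a least-squares projection under volume sampling: they are
unbiased, with a small second moment. -/
theorem exists_coeff [IsProbabilityMeasure μ] {m n : ℕ} {φ : Fin m → X → ℝ} {f : X → ℝ}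
    {α ε₀ ε : ℝ} (hα : 0 < α) (hε₀ : 0 < ε₀) (hε : 0 < ε) (hεε₀ : ε ≤ ε₀)
    (hm : 1 ≤ m) (hφ : IsOrthonormalSystem μ φ) (hw : Measurable w) (hw0 : ∀ x, 0 ≤ w x)
    (hν : IsProbabilityMeasure (densityMeasure μ w))
    (hαw : ∀ᵐ x ∂μ, α * optDensity φ x ≤ w x) (hf : MemLp f 2 μ) (hmn : m ≤ n)
    (hn : oversampling α ε₀ * (m * Real.log (ε⁻¹ * m) + m * ε⁻¹) ≤ n) :
    ∃ Z : Fin m → (Fin n → X) → ℝ, (∀ k, Measurable (Z k)) ∧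
      (∀ k, MemLp (Z k) 2 (volumeSampling μ w φ n)) ∧
      (∀ k, ∫ x, Z k x ∂(volumeSampling μ w φ n) = 0) ∧
      ∑ k, ∫ x, Z k x ^ 2 ∂(volumeSampling μ w φ n) ≤ ε * sqNorm μ (f - l2Proj μ φ f) ∧
      ∀ᵐ x ∂(volumeSampling μ w φ n), ∀ g, IsLeastSquaresProj w (approxSpace φ) x f g →
        g = l2Proj μ φ f + ∑ k, Z k x • φ k := by
  obtain ⟨ψ, r, hd, hψ, hr, hr2⟩ := exists_isDesign hα hm hφ hw hw0 hαw hf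
  set ν := densityMeasure μ w with hνdef
  set c : ℝ := ((n - m).factorial : ℝ) / (n.factorial : ℝ) with hc
  have hc0 : 0 ≤ c := by positivity
  have hcn : c * (n.descFactorial m : ℝ) = 1 := by
    have h1 : ((n - m).factorial : ℝ) * n.descFactorial m = n.factorial := by
      exact_mod_cast Nat.factorial_mul_descFactorial hmn
    rw [hc, div_mul_eq_mul_div, h1, div_self (by positivity)]
  have hΦ : ∀ᵐ x ∂(Measure.pi fun _ : Fin n => ν),
      featureMatrix w φ x = evalMatrix ψ x ∧
      (fun i => (√(w (x i)))⁻¹ * (f - l2Proj μ φ f) (x i)) = fun i => r (x i) := by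
    filter_upwards [ae_pi_forall (n := n) (ae_all_iff.2 hψ), ae_pi_forall (n := n) hr] with x h1 h2
    refine ⟨?_, funext fun i => (h2 i).symm⟩
    ext i j
    exact (h1 i j).symm
  set D : (Fin n → X) → ℝ := fun x => ((evalMatrix ψ x)ᵀ * evalMatrix ψ x).det with hD
  have hDm : Measurable D := measurable_det_gram hd.measurable
  have hD0 : ∀ x, 0 ≤ D x := fun x => det_gram_nonneg _
  have hcD : Measurable fun x => ENNReal.ofReal (c * D x) := (hDm.const_mul c).ennreal_ofReal
  have hγ : volumeSampling μ w φ n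
      = (Measure.pi fun _ : Fin n => ν).withDensity fun x => ENNReal.ofReal (c * D x) := by
    rw [volumeSampling]
    refine withDensity_congr_ae ?_
    filter_upwards [hΦ] with x hx
    rw [hx.1]
  have hint : ∀ g : (Fin n → X) → ℝ, ∫ x, g x ∂(volumeSampling μ w φ n)
      = c * ∫ x, D x * g x ∂(Measure.pi fun _ : Fin n => ν) := by
    intro g
    rw [hγ, integral_withDensity_eq_integral_toReal_smul hcD
      (ae_of_all _ fun x => ENNReal.ofReal_lt_top), ← integral_const_mul]
    refine integral_congr_ae (ae_of_all _ fun x => ?_)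
    simp only [ENNReal.toReal_ofReal (mul_nonneg hc0 (hD0 x)), smul_eq_mul, mul_assoc]
  have hinteg : ∀ g : (Fin n → X) → ℝ,
      Integrable (fun x => D x * g x) (Measure.pi fun _ : Fin n => ν) →
      Integrable g (volumeSampling μ w φ n) := by
    intro g hg
    rw [hγ, integrable_withDensity_iff_integrable_smul' hcD
      (ae_of_all _ fun x => ENNReal.ofReal_lt_top)]
    refine (hg.const_mul c).congr (ae_of_all _ fun x => ?_)
    simp only [ENNReal.toReal_ofReal (mul_nonneg hc0 (hD0 x)), smul_eq_mul, mul_assoc]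
  set Z : Fin m → (Fin n → X) → ℝ := fun k x =>
    lsCoeff (evalMatrix ψ x) (fun i => r (x i)) k with hZ
  refine ⟨Z, hd.measurable_lsCoeff, fun k => ?_, fun k => ?_, ?_, ?_⟩
  · rw [memLp_two_iff_integrable_sq (hd.measurable_lsCoeff k).aestronglyMeasurable]
    exact hinteg _ (hd.integrable_det_mul_sq k)
  · rw [hint, (hd.integral_det_mul_lsCoeff k).2, mul_zero]
  · have h1 := hd.integral_det_mul_sum_sq_le_of_oversampling hα hε₀ hε hεε₀ hm hmn hn
    simp_rw [Finset.mul_sum] at h1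
    rw [integral_finsetSum _ fun k _ => hd.integrable_det_mul_sq k] at h1
    simp_rw [hint]
    rw [← Finset.mul_sum]
    calc c * ∑ k, ∫ x, D x * Z k x ^ 2 ∂(Measure.pi fun _ : Fin n => ν)
        ≤ c * ((n.descFactorial m : ℝ) * (ε * ∫ y, r y ^ 2 ∂ν)) :=
          mul_le_mul_of_nonneg_left h1 hc0
      _ = ε * ∫ y, r y ^ 2 ∂ν := by rw [← mul_assoc, hcn, one_mul]
      _ ≤ _ := mul_le_mul_of_nonneg_left hr2 hε.le
  · rw [hγ, ae_withDensity_iff hcD]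
    filter_upwards [hΦ] with x hx hne g hg
    -- The sampling density is proportional to the determinant, so singular designs are null and the
    -- minimizer is a.s. unique.
    have hdet : D x ≠ 0 := by
      intro h0
      rw [h0, mul_zero, ENNReal.ofReal_zero] at hne
      exact hne rfl
    rw [hD] at hdet
    simp only [← hx.1] at hdet
    have h1 := hg.eq_l2Proj_add (μ := μ) (by omega) hw0 hdet
    rw [hx.1, hx.2] at h1
    exact h1

end Transfer

/-! ### Averages of independent projections. -/

theorem sum_smul_mem_approxSpace {X : Type*} {m : ℕ} (φ : Fin m → X → ℝ) (c : Fin m → ℝ) :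
    ∑ j, c j • φ j ∈ approxSpace φ :=
  Submodule.sum_mem _ fun j _ =>
    Submodule.smul_mem _ _ (Submodule.subset_span (Set.mem_range_self j))

section Average

variable {X : Type u} [MeasurableSpace X] {μ : Measure X} {m : ℕ} {φ : Fin m → X → ℝ} {f : X → ℝ}

theorem sqNorm_sum_smul (hφ : IsOrthonormalSystem μ φ) (c : Fin m → ℝ) :
    sqNorm μ (∑ j, c j • φ j) = ∑ j, c j ^ 2 := by
  have h1 : ∀ y, (∑ j, c j • φ j) y ^ 2 = ∑ k, ∑ l, c k * c l * (φ k y * φ l y) := by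
    intro y
    simp only [Finset.sum_apply, Pi.smul_apply, smul_eq_mul, pow_two, Finset.sum_mul_sum]
    exact Finset.sum_congr rfl fun k _ => Finset.sum_congr rfl fun l _ => by ring
  have h2 : ∀ k l, Integrable (fun y => c k * c l * (φ k y * φ l y)) μ := fun k l =>
    ((hφ.memLp k).integrable_mul (hφ.memLp l)).const_mul _
  simp_rw [sqNorm, h1]
  rw [integral_finsetSum _ fun k _ => integrable_finsetSum _ fun l _ => h2 k l]
  refine Finset.sum_congr rfl fun k _ => ?_
  rw [integral_finsetSum _ fun l _ => h2 k l]
  simp [integral_const_mul, hφ.integral_mul, pow_two]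

theorem sqNorm_sub_l2Proj_add (hφ : IsOrthonormalSystem μ φ) (hf : MemLp f 2 μ) {h : X → ℝ}
    (hh : h ∈ approxSpace φ) :
    sqNorm μ (f - (l2Proj μ φ f + h)) = sqNorm μ (f - l2Proj μ φ f) + sqNorm μ h := by
  have hp : MemLp (f - l2Proj μ φ f) 2 μ := hf.sub (memLp_of_mem hφ (l2Proj_mem μ φ f))
  have hhL := memLp_of_mem hφ hh
  have h1 : ∀ y, (f - (l2Proj μ φ f + h)) y ^ 2
      = (f - l2Proj μ φ f) y ^ 2 - 2 * ((f y - l2Proj μ φ f y) * h y) + h y ^ 2 := by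
    intro y
    simp only [Pi.sub_apply, Pi.add_apply]
    ring
  have h2 : Integrable (fun y => 2 * ((f y - l2Proj μ φ f y) * h y)) μ :=
    (hp.integrable_mul hhL).const_mul 2
  have h3 : Integrable
      (fun y => (f - l2Proj μ φ f) y ^ 2 - 2 * ((f y - l2Proj μ φ f y) * h y)) μ :=
    hp.integrable_sq.sub h2
  simp_rw [sqNorm, h1]
  rw [integral_add h3 hhL.integrable_sq,
    integral_sub hp.integrable_sq h2, integral_const_mul, integral_sub_l2Proj_mul hφ hf hh,
    mul_zero, sub_zero]

/-- The variance of a mean of `r` independent, identically distributed centred variables is that of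
one of them divided by `r`. -/
theorem integral_average_sq {Ω : Type v} [MeasurableSpace Ω] {P : Measure Ω}
    [IsProbabilityMeasure P] {S : Type*} [MeasurableSpace S] {γ : Measure S} {r : ℕ} (hr : 1 ≤ r)
    {x : Fin r → Ω → S} (hx : iIndepFun x P) (hlaw : ∀ k, HasLaw (x k) γ P) {Z : S → ℝ}
    (hZ : Measurable Z) (hZ2 : MemLp Z 2 γ) (hZ0 : ∫ s, Z s ∂γ = 0) :
    Integrable (fun ω => (1 / (r : ℝ) * ∑ k, Z (x k ω)) ^ 2) P ∧
    ∫ ω, (1 / (r : ℝ) * ∑ k, Z (x k ω)) ^ 2 ∂P = 1 / (r : ℝ) * ∫ s, Z s ^ 2 ∂γ := by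
  have hr0 : (0 : ℝ) < r := by exact_mod_cast hr
  have hYL : ∀ k, MemLp (fun ω => Z (x k ω)) 2 P := by
    intro k
    have h1 : MemLp Z 2 (P.map (x k)) := by rw [(hlaw k).map_eq]; exact hZ2
    exact (memLp_map_measure_iff hZ.aestronglyMeasurable (hlaw k).aemeasurable).1 h1
  have hY0 : ∀ k, ∫ ω, Z (x k ω) ∂P = 0 := fun k =>
    ((hlaw k).integral_comp hZ.aestronglyMeasurable).trans hZ0
  have hYsq : ∀ k, ∫ ω, Z (x k ω) ^ 2 ∂P = ∫ s, Z s ^ 2 ∂γ := fun k =>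
    (hlaw k).integral_comp (f := fun s => Z s ^ 2) (hZ.pow_const 2).aestronglyMeasurable
  have hindep : iIndepFun (fun k ω => Z (x k ω)) P := hx.comp (fun _ => Z) fun _ => hZ
  have hsumL : MemLp (∑ k, fun ω => Z (x k ω)) 2 P := memLp_finsetSum' _ fun k _ => hYL k
  have hvar : ∫ ω, (∑ k, Z (x k ω)) ^ 2 ∂P = r * ∫ s, Z s ^ 2 ∂γ := by
    have h1 := IndepFun.variance_sum (μ := P) (s := Finset.univ)
      (X := fun k ω => Z (x k ω)) (fun k _ => hYL k) fun i _ j _ hij => hindep.indepFun hij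
    have h2 : ∫ ω, (∑ k, fun ω => Z (x k ω)) ω ∂P = 0 := by
      simp only [Finset.sum_apply]
      rw [integral_finsetSum _ fun k _ => (hYL k).integrable (by norm_num)]
      simp [hY0]
    rw [variance_of_integral_eq_zero hsumL.aemeasurable h2] at h1
    have h3 : ∀ k, variance (fun ω => Z (x k ω)) P = ∫ s, Z s ^ 2 ∂γ := fun k => by
      rw [variance_of_integral_eq_zero (hYL k).aemeasurable (hY0 k), ← hYsq k]
    simp only [Finset.sum_apply, h3] at h1
    simpa using h1
  simp_rw [mul_pow]
  have hsq : Integrable (fun ω => (∑ k, Z (x k ω)) ^ 2) P := by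
    simpa using hsumL.integrable_sq
  refine ⟨hsq.const_mul _, ?_⟩
  rw [integral_const_mul, hvar]
  field_simp

/-- The errors of an average of independent least-squares projections. -/
theorem integral_sqNorm_average (hφ : IsOrthonormalSystem μ φ) (hf : MemLp f 2 μ) {w : X → ℝ}
    {n : ℕ} {γ : Measure (Fin n → X)} {Z : Fin m → (Fin n → X) → ℝ} (hZ : ∀ j, Measurable (Z j))
    (hZ2 : ∀ j, MemLp (Z j) 2 γ) (hZ0 : ∀ j, ∫ s, Z j s ∂γ = 0)
    (hZg : ∀ᵐ x ∂γ, ∀ g, IsLeastSquaresProj w (approxSpace φ) x f g →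
        g = l2Proj μ φ f + ∑ k, Z k x • φ k)
    {Ω : Type v} [MeasurableSpace Ω] {P : Measure Ω}
    [IsProbabilityMeasure P] {r : ℕ} (hr : 1 ≤ r) {x : Fin r → Ω → Fin n → X}
    {fhat : Fin r → Ω → X → ℝ} (hx : iIndepFun x P) (hlaw : ∀ k, HasLaw (x k) γ P)
    (hls : ∀ k, ∀ᵐ ω ∂P, IsLeastSquaresProj w (approxSpace φ) (x k ω) f (fhat k ω)) :
    (Integrable (fun ω => sqNorm μ (f - average fun k => fhat k ω)) P ∧
      ∫ ω, sqNorm μ (f - average fun k => fhat k ω) ∂P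
        = sqNorm μ (f - l2Proj μ φ f) + 1 / (r : ℝ) * ∑ j, ∫ s, Z j s ^ 2 ∂γ) ∧
    (Integrable (fun ω => sqNorm μ ((average fun k => fhat k ω) - l2Proj μ φ f)) P ∧
      ∫ ω, sqNorm μ ((average fun k => fhat k ω) - l2Proj μ φ f) ∂P
        = 1 / (r : ℝ) * ∑ j, ∫ s, Z j s ^ 2 ∂γ) := by
  have hr0 : (r : ℝ) ≠ 0 := by positivity
  set M : Fin m → Ω → ℝ := fun j ω => 1 / (r : ℝ) * ∑ k, Z j (x k ω) with hM
  have havg : ∀ᵐ ω ∂P, (average fun k => fhat k ω) = l2Proj μ φ f + ∑ j, M j ω • φ j := by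
    have h1 : ∀ k, ∀ᵐ ω ∂P, fhat k ω = l2Proj μ φ f + ∑ j, Z j (x k ω) • φ j := by
      intro k
      have h2 := hZg
      rw [← (hlaw k).map_eq] at h2
      filter_upwards [ae_of_ae_map (hlaw k).aemeasurable h2, hls k] with ω h3 h4
      exact h3 _ h4
    filter_upwards [ae_all_iff.2 h1] with ω hω
    funext y
    simp only [average, hω, hM, Pi.add_apply, Finset.sum_apply, Pi.smul_apply, smul_eq_mul,
      Finset.sum_add_distrib, Finset.sum_const, Finset.card_univ, Fintype.card_fin, nsmul_eq_mul,
      mul_add]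
    rw [← mul_assoc, one_div, inv_mul_cancel₀ hr0, one_mul, Finset.sum_comm]
    simp only [Finset.mul_sum, Finset.sum_mul, mul_assoc]
  have hMsq := fun j => integral_average_sq hr hx hlaw (hZ j) (hZ2 j) (hZ0 j)
  have h1 : (fun ω => sqNorm μ (f - average fun k => fhat k ω))
      =ᵐ[P] fun ω => sqNorm μ (f - l2Proj μ φ f) + ∑ j, M j ω ^ 2 := by
    filter_upwards [havg] with ω hω
    rw [hω, sqNorm_sub_l2Proj_add hφ hf (sum_smul_mem_approxSpace φ _), sqNorm_sum_smul hφ]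
  have h2 : (fun ω => sqNorm μ ((average fun k => fhat k ω) - l2Proj μ φ f))
      =ᵐ[P] fun ω => ∑ j, M j ω ^ 2 := by
    filter_upwards [havg] with ω hω
    rw [hω, add_sub_cancel_left, sqNorm_sum_smul hφ]
  have h3 : Integrable (fun ω => ∑ j, M j ω ^ 2) P :=
    integrable_finsetSum _ fun j _ => (hMsq j).1
  have h4 : ∫ ω, ∑ j, M j ω ^ 2 ∂P = 1 / (r : ℝ) * ∑ j, ∫ s, Z j s ^ 2 ∂γ := by
    rw [integral_finsetSum _ fun j _ => (hMsq j).1, Finset.mul_sum]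
    exact Finset.sum_congr rfl fun j _ => (hMsq j).2
  refine ⟨⟨((integrable_const _).add h3).congr h1.symm, ?_⟩, h3.congr h2.symm, ?_⟩
  · rw [integral_congr_ae h1, integral_add (integrable_const _) h3, h4]
    simp
  · rw [integral_congr_ae h2, h4]

theorem xi_nonneg (μ : Measure X) (w : X → ℝ) (φ : Fin m → X → ℝ) : 0 ≤ xi μ w φ := by
  rw [xi]
  split_ifs <;> norm_num

end Average

end VolumeSampling

/-! ### Conclusion. -/

theorem mainTheorem5 (α ε₀ : ℝ) (hα : 0 < α) (hε₀ : 0 < ε₀) :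
    ∃ C : ℝ, 0 < C ∧
      ∀ (X : Type u) [MeasurableSpace X] (μ : Measure X) [IsProbabilityMeasure μ]
        (m : ℕ) (φ : Fin m → X → ℝ) (w f : X → ℝ) (ε : ℝ) (n : ℕ),
        1 ≤ m →
        VolumeSampling.IsOrthonormalSystem μ φ →
        Measurable w →
        (∀ x, 0 ≤ w x) →
        IsProbabilityMeasure (VolumeSampling.densityMeasure μ w) →
        (∀ᵐ x ∂μ, α * VolumeSampling.optDensity φ x ≤ w x) →
        MemLp f 2 μ →
        0 < ε → ε ≤ ε₀ →
        m ≤ n →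
        C * (m * Real.log (ε⁻¹ * m) + m * (1 + VolumeSampling.xi μ w φ * m) * ε⁻¹) ≤ n →
        -- the error bound for `r` independent projections
        (∀ (r : ℕ), 1 ≤ r →
          ∀ (Ω : Type v) [MeasurableSpace Ω] (P : Measure Ω) [IsProbabilityMeasure P]
            (x : Fin r → Ω → Fin n → X) (fhat : Fin r → Ω → X → ℝ),
            iIndepFun x P →
            (∀ k, HasLaw (x k) (VolumeSampling.volumeSampling μ w φ n) P) →
            (∀ k, ∀ᵐ ω ∂P, VolumeSampling.IsLeastSquaresProj w (VolumeSampling.approxSpace φ)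
              (x k ω) f (fhat k ω)) →
            Integrable (fun ω => VolumeSampling.sqNorm μ
              (f - VolumeSampling.average fun k => fhat k ω)) P ∧
            ∫ ω, VolumeSampling.sqNorm μ (f - VolumeSampling.average fun k => fhat k ω) ∂P
              ≤ (1 + 1 / (r : ℝ) * (1 + VolumeSampling.xi μ w φ * m) * ε) *
                VolumeSampling.sqNorm μ (f - VolumeSampling.l2Proj μ φ f)) ∧
        -- convergence to the best approximation as `r → ∞`
        (∀ (Ω : Type v) [MeasurableSpace Ω] (P : Measure Ω) [IsProbabilityMeasure P]
            (x : ℕ → Ω → Fin n → X) (fhat : ℕ → Ω → X → ℝ),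
            iIndepFun x P →
            (∀ k, HasLaw (x k) (VolumeSampling.volumeSampling μ w φ n) P) →
            (∀ k, ∀ᵐ ω ∂P, VolumeSampling.IsLeastSquaresProj w (VolumeSampling.approxSpace φ)
              (x k ω) f (fhat k ω)) →
            Tendsto (fun r : ℕ => ∫ ω, VolumeSampling.sqNorm μ
                (f - VolumeSampling.average fun k : Fin r => fhat k ω) ∂P)
              atTop (𝓝 (VolumeSampling.sqNorm μ (f - VolumeSampling.l2Proj μ φ f))) ∧
            (∀ r : ℕ, 1 ≤ r → Integrable (fun ω => VolumeSampling.sqNorm μ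
              ((VolumeSampling.average fun k : Fin r => fhat k ω) -
                VolumeSampling.l2Proj μ φ f)) P) ∧
            Tendsto (fun r : ℕ => ∫ ω, VolumeSampling.sqNorm μ
                ((VolumeSampling.average fun k : Fin r => fhat k ω) -
                  VolumeSampling.l2Proj μ φ f) ∂P)
              atTop (𝓝 0)) := by
  refine ⟨VolumeSampling.oversampling α ε₀,
    by rw [VolumeSampling.oversampling]; positivity, ?_⟩
  intro X _ μ _ m φ w f ε n hm hφ hw hw0 hν hαw hf hε hεε₀ hmn hn
  have hξ := VolumeSampling.xi_nonneg μ w φ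
  have hm0 : (0 : ℝ) < m := by exact_mod_cast hm
  have hC : 0 ≤ VolumeSampling.oversampling α ε₀ := by
    rw [VolumeSampling.oversampling]; positivity
  have hξm : 1 ≤ 1 + VolumeSampling.xi μ w φ * m :=
    le_add_of_nonneg_right (mul_nonneg hξ hm0.le)
  -- Nonnegativity of `ξ` is enough here: the coefficients already satisfy the second-moment bound
  -- with `ε`, and the factor `1 + ξ m ≥ 1` is reinserted at the end.
  have hn' : VolumeSampling.oversampling α ε₀ * (m * Real.log (ε⁻¹ * m) + m * ε⁻¹) ≤ n := by
    refine le_trans (mul_le_mul_of_nonneg_left ?_ hC) hn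
    gcongr
    exact le_mul_of_one_le_right hm0.le hξm
  obtain ⟨Z, hZ, hZ2, hZ0, hZε, hZg⟩ :=
    VolumeSampling.exists_coeff hα hε₀ hε hεε₀ hm hφ hw hw0 hν hαw hf hmn hn'
  set V := ∑ k, ∫ x, Z k x ^ 2 ∂(VolumeSampling.volumeSampling μ w φ n)
  set R := VolumeSampling.sqNorm μ (f - VolumeSampling.l2Proj μ φ f)
  have hR : 0 ≤ R := integral_nonneg fun y => sq_nonneg _
  refine ⟨?_, ?_⟩
  · intro r hr Ω _ P _ x fhat hx hlaw hls
    obtain ⟨⟨h1, h2⟩, -⟩ :=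
      VolumeSampling.integral_sqNorm_average hφ hf hZ hZ2 hZ0 hZg hr hx hlaw hls
    refine ⟨h1, h2.le.trans ?_⟩
    have h3 : V ≤ (1 + VolumeSampling.xi μ w φ * m) * (ε * R) :=
      hZε.trans (le_mul_of_one_le_left (mul_nonneg hε.le hR) hξm)
    have h4 : 1 / (r : ℝ) * V ≤ 1 / (r : ℝ) * ((1 + VolumeSampling.xi μ w φ * m) * (ε * R)) :=
      mul_le_mul_of_nonneg_left h3 (by positivity)
    refine (add_le_add_right h4 R).trans (le_of_eq ?_)
    ring
  · intro Ω _ P _ x fhat hx hlaw hls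
    have key := fun (r : ℕ) (hr : 1 ≤ r) =>
      VolumeSampling.integral_sqNorm_average hφ hf hZ hZ2 hZ0 hZg hr
        (x := fun k : Fin r => x k) (fhat := fun k : Fin r => fhat k)
        (hx.precomp Fin.val_injective) (fun k => hlaw k) (fun k => hls k)
    have hlim : Tendsto (fun r : ℕ => 1 / (r : ℝ) * V) atTop (𝓝 0) := by
      simpa using tendsto_one_div_atTop_nhds_zero_nat.mul_const V
    refine ⟨?_, fun r hr => (key r hr).2.1, ?_⟩
    · have hlim' : Tendsto (fun r : ℕ => R + 1 / (r : ℝ) * V) atTop (𝓝 R) := by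
        simpa using hlim.const_add R
      -- The exact formula holds only for `r ≥ 1`, since the average over an empty family is zero;
      -- hence equality along the filter.
      refine hlim'.congr' ?_
      filter_upwards [eventually_ge_atTop 1] with r hr
      exact (key r hr).1.2.symm
    · refine hlim.congr' ?_
      filter_upwards [eventually_ge_atTop 1] with r hr
      exact (key r hr).2.2.symm
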